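/- Let $L=K_1\cup\dots\cup K_\mu$ be a classical oriented link with $\mu\le 2$ components, and let $D$ be a diagram of $L$ without virtual crossings, with set of arcs $A(D)$ (the components are cut at the underpasses) and set of crossings $C(D)$. For a crossing $c$ let $a(c)$ be the overpassing arc, and let $b_1(c)$, $b_2(c)$ be the underpassing arcs on the right and on the left of $a(c)$, respectively. Put $\Lambda=\mathbb Z[t,t^{-1}]$. A quandle is a set with an operation $\triangleright$ such that $x\triangleright x=x$, every translation $\beta_y(x)=x\triangleright y$ is a permutation, and $(x\triangleright y)\triangleright z=(x\triangleright z)\triangleright(y\triangleright z)$; it is medial if $(w\triangleright x)\triangleright(y\triangleright z)=(w\triangleright y)\triangleright(x\triangleright z)$ for all $w,x,y,z$. Let $\mathrm{MQ}(L)$ be the medial quandle with generators $q_a$ $(a\in A(D))$ and relations $q_{b_2(c)}=q_{b_1(c)}\triangleright q_{a(c)}$ $(c\in C(D))$. Let $\mathrm{IMQ}(L)$ be its involutory quotient, i.e. the quandle with a generator $x_{\mathrm{inv}}$ for each $x\in \mathrm{MQ}(L)$ and relations $x_{\mathrm{inv}}\triangleright y_{\mathrm{inv}}=(x\triangleright y)_{\mathrm{inv}}$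 and $((x\triangleright y)\triangleright y)_{\mathrm{inv}}=x_{\mathrm{inv}}$ for all $x,y\in\mathrm{MQ}(L)$. Let $M_A^{\mathrm{red}}(L)$ be the $\Lambda$-module with generators $\varsigma(a)$ $(a\in A(D))$ and relations $(1-t)\varsigma(a(c))+t\varsigma(b_1(c))-\varsigma(b_2(c))=0$ $(c\in C(D))$. Let $\phi_\tau:M_A^{\mathrm{red}}(L)\to\Lambda\oplus\mathbb Z^{\mu-1}$ (with $t$ acting trivially on $\mathbb Z^{\mu-1}$) be the $\Lambda$-linear map which sends $\varsigma(a)$ to $(1,0,\dots,0)$ if $a$ belongs to $K_1$, and to $(1,0,\dots,1,\dots,0)$, with the second $1$ in the $i$th coordinate, if $a$ belongs to $K_i$ with $i>1$; let $\phi^{\mathrm{red}}_L:M_A^{\mathrm{red}}(L)\to\Lambda$ be its first coordinate. A meridian of $K_i$ is an element $x\in M_A^{\mathrm{red}}(L)$ with $\phi_\tau(x)=\phi_\tau(\varsigma(a))$ for some arc $a$ of $K_i$. Regard $\Lambda$-modules as quandles with the operation $x\triangleright y=tx+(1-t)y$. Choose any meridian $m_i$ of $K_i$ for each $i$, and let $$Q_A^{\mathrm{red}}(L)=\bigcup_{i=1}^{\mu}\bigl(m_i+(1-t)\ker\phi^{\mathrm{red}}_L\bigr)\subseteq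 M_A^{\mathrm{red}}(L),$$ a subquandle of $M_A^{\mathrm{red}}(L)$. Then $\mathrm{IMQ}(L)$ is isomorphic, as a quandle, to the image of $Q_A^{\mathrm{red}}(L)$ in the quotient module $M_A^{\mathrm{red}}(L)/(1+t)M_A^{\mathrm{red}}(L)$. (No hypothesis on $\det L$ is made.) -/

import Mathlib

open scoped LaurentPolynomial Quandles

noncomputable section

/-! ## Quandles

Mathlib writes `Shelf.act y x = y ◃ x` for the image of `x` under the translation by `y`;
the usual right-handed notation for this element is `x ▷ y`. -/

/-- Two quandles are isomorphic: there is a bijective quandle homomorphism. -/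
def QuandleIsomorphic (Q₁ Q₂ : Type*) [Quandle Q₁] [Quandle Q₂] : Prop :=
  ∃ f : Q₁ →◃ Q₂, Function.Bijective f

/-- Formal words in the two quandle operations over a set `X` of generators. -/
inductive QuandleWord (X : Type*) where
  | gen : X → QuandleWord X
  | act : QuandleWord X → QuandleWord X → QuandleWord X
  | invAct : QuandleWord X → QuandleWord X → QuandleWord X

/-- The smallest congruence on words which contains the relations `R` and the quandle axioms. -/
inductive QuandleWord.Congr {X : Type*} (R : QuandleWord X → QuandleWord X → Prop) :
    QuandleWord X → QuandleWord X → Prop where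
  | of {a b} : R a b → Congr R a b
  | refl (a) : Congr R a a
  | symm {a b} : Congr R a b → Congr R b a
  | trans {a b c} : Congr R a b → Congr R b c → Congr R a c
  | act {a a' b b'} : Congr R a a' → Congr R b b' → Congr R (.act a b) (.act a' b')
  | invAct {a a' b b'} : Congr R a a' → Congr R b b' → Congr R (.invAct a b) (.invAct a' b')
  | self_distrib (a b c) : Congr R (.act a (.act b c)) (.act (.act a b) (.act a c))
  | left_inv (a b) : Congr R (.invAct a (.act a b)) b
  | right_inv (a b) : Congr R (.act a (.invAct a b)) b
  | fix (a) : Congr R (.act a a) a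

/-- The setoid of the congruence `QuandleWord.Congr R`. -/
def QuandleWord.congrSetoid {X : Type*} (R : QuandleWord X → QuandleWord X → Prop) :
    Setoid (QuandleWord X) where
  r := QuandleWord.Congr R
  iseqv := ⟨.refl, .symm, .trans⟩

/-- The quandle with generators `X` and defining relations `R`. -/
def PresentedQuandle {X : Type*} (R : QuandleWord X → QuandleWord X → Prop) : Type _ :=
  Quotient (QuandleWord.congrSetoid R)

instance PresentedQuandle.instQuandle {X : Type*} (R : QuandleWord X → QuandleWord X → Prop) :
    Quandle (PresentedQuandle R) where
  act := Quotient.map₂ .act fun _ _ h _ _ h' => .act h h'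
  invAct := Quotient.map₂ .invAct fun _ _ h _ _ h' => .invAct h h'
  self_distrib := by
    rintro ⟨a⟩ ⟨b⟩ ⟨c⟩
    exact Quotient.sound (.self_distrib a b c)
  left_inv := by
    rintro ⟨a⟩ ⟨b⟩
    exact Quotient.sound (.left_inv a b)
  right_inv := by
    rintro ⟨a⟩ ⟨b⟩
    exact Quotient.sound (.right_inv a b)
  fix := by
    rintro ⟨a⟩
    exact Quotient.sound (.fix a)

/-- The relations `R` together with all instances of mediality
`(w ▷ x) ▷ (y ▷ z) = (w ▷ y) ▷ (x ▷ z)`. The quandle presented by these relations is the medial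
quandle with generators `X` and defining relations `R`. -/
inductive QuandleWord.MedialRel {X : Type*} (R : QuandleWord X → QuandleWord X → Prop) :
    QuandleWord X → QuandleWord X → Prop where
  | of {a b} : R a b → MedialRel R a b
  | medial (w x y z) :
      MedialRel R (.act (.act z y) (.act x w)) (.act (.act z x) (.act y w))

/-- The relations `x_inv ▷ y_inv = (x ▷ y)_inv` and `((x ▷ y) ▷ y)_inv = x_inv`
between generators `x_inv` indexed by the elements `x` of a quandle `Q`. -/
inductive InvolutoryRel (Q : Type*) [Quandle Q] : QuandleWord Q → QuandleWord Q → Prop where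
  | op (x y : Q) : InvolutoryRel Q (.act (.gen y) (.gen x)) (.gen (y ◃ x))
  | invol (x y : Q) : InvolutoryRel Q (.gen (y ◃ (y ◃ x))) (.gen x)

/-- The involutory quotient `Q_inv` of a quandle `Q`. -/
abbrev InvolutoryQuotient (Q : Type*) [Quandle Q] : Type _ :=
  PresentedQuandle (InvolutoryRel Q)

/-- A subquandle of a quandle: a subset closed under both quandle operations. -/
structure Subquandle (Q : Type*) [Quandle Q] where
  carrier : Set Q
  act_mem : ∀ {x y : Q}, x ∈ carrier → y ∈ carrier → (x ◃ y) ∈ carrier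
  invAct_mem : ∀ {x y : Q}, x ∈ carrier → y ∈ carrier → (x ◃⁻¹ y) ∈ carrier

instance Subquandle.instQuandle {Q : Type*} [Quandle Q] (S : Subquandle Q) :
    Quandle S.carrier where
  act x y := ⟨x.1 ◃ y.1, S.act_mem x.2 y.2⟩
  invAct x y := ⟨x.1 ◃⁻¹ y.1, S.invAct_mem x.2 y.2⟩
  self_distrib := Subtype.ext Shelf.self_distrib
  left_inv x y := Subtype.ext (Rack.left_inv x.1 y.1)
  right_inv x y := Subtype.ext (Rack.right_inv x.1 y.1)
  fix := Subtype.ext Quandle.fix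

/-- A quandle homomorphism preserves the inverse operations. -/
theorem ShelfHom.map_invAct_quandle {Q Q' : Type*} [Quandle Q] [Quandle Q'] (f : Q →◃ Q')
    (x y : Q) : f (x ◃⁻¹ y) = f x ◃⁻¹ f y := by
  rw [← Rack.left_cancel (f x), ← f.map_act, Rack.right_inv, Rack.right_inv]

/-- The image of a subquandle under a quandle homomorphism. -/
def Subquandle.map {Q Q' : Type*} [Quandle Q] [Quandle Q'] (S : Subquandle Q) (f : Q →◃ Q') :
    Subquandle Q' where
  carrier := f '' S.carrier
  act_mem := by
    rintro _ _ ⟨x, hx, rfl⟩ ⟨y, hy, rfl⟩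
    exact ⟨_, S.act_mem hx hy, f.map_act⟩
  invAct_mem := by
    rintro _ _ ⟨x, hx, rfl⟩ ⟨y, hy, rfl⟩
    exact ⟨_, S.invAct_mem hx hy, f.map_invAct_quandle x y⟩

/-! ## Modules over `Λ = ℤ[t, t⁻¹]` and standard Alexander quandles -/

/-- The variable `t` of `Λ = ℤ[t, t⁻¹]`. -/
abbrev tΛ : ℤ[T;T⁻¹] := LaurentPolynomial.T 1

/-- The inverse `t⁻¹` of the variable of `Λ = ℤ[t, t⁻¹]`. -/
abbrev tInvΛ : ℤ[T;T⁻¹] := LaurentPolynomial.T (-1)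

theorem tΛ_mul_tInvΛ : tΛ * tInvΛ = 1 := by
  rw [← LaurentPolynomial.T_add]
  simp

theorem tInvΛ_mul_tΛ : tInvΛ * tΛ = 1 := by
  rw [mul_comm, tΛ_mul_tInvΛ]

/-- The underlying set of a `Λ`-module `M`, regarded as a standard Alexander (affine) quandle. -/
def AlexanderQuandle (M : Type*) : Type _ := M

/-- `x ▷ y = t x + (1 - t) y` and `x ▷⁻¹ y = t⁻¹ x + (1 - t⁻¹) y`. -/
instance AlexanderQuandle.instQuandle (M : Type*) [AddCommGroup M] [Module ℤ[T;T⁻¹] M] :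
    Quandle (AlexanderQuandle M) where
  act := fun (y x : M) => (tΛ • x + (1 - tΛ) • y : M)
  invAct := fun (y x : M) => (tInvΛ • x + (1 - tInvΛ) • y : M)
  self_distrib := by
    intro (x : M) (y : M) (z : M)
    change tΛ • (tΛ • z + (1 - tΛ) • y) + (1 - tΛ) • x =
      tΛ • (tΛ • z + (1 - tΛ) • x) + (1 - tΛ) • (tΛ • y + (1 - tΛ) • x)
    module
  left_inv := by
    intro (x : M) (y : M)
    change tInvΛ • (tΛ • y + (1 - tΛ) • x) + (1 - tInvΛ) • x = y
    have h := tInvΛ_mul_tΛ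
    linear_combination (norm := module) h • (y - x)
  right_inv := by
    intro (x : M) (y : M)
    change tΛ • (tInvΛ • y + (1 - tInvΛ) • x) + (1 - tΛ) • x = y
    have h := tΛ_mul_tInvΛ
    linear_combination (norm := module) h • (y - x)
  fix := by
    intro (x : M)
    change tΛ • x + (1 - tΛ) • x = x
    module

/-- A `Λ`-linear map is a homomorphism of standard Alexander quandles. -/
def AlexanderQuandle.map {M N : Type*} [AddCommGroup M] [Module ℤ[T;T⁻¹] M] [AddCommGroup N]
    [Module ℤ[T;T⁻¹] N] (f : M →ₗ[ℤ[T;T⁻¹]] N) : AlexanderQuandle M →◃ AlexanderQuandle N where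
  toFun := fun x : M => (f x : N)
  map_act' := by
    intro (x : M) (y : M)
    change f (tΛ • y + (1 - tΛ) • x) = tΛ • f y + (1 - tΛ) • f x
    simp only [map_add, map_smul]

/-- The abelian group `ℤ ^ ι` with the trivial action `t • n = n`. -/
def TrivialModule (ι : Type*) : Type _ := ι → ℤ

instance TrivialModule.instAddCommGroup (ι : Type*) : AddCommGroup (TrivialModule ι) :=
  inferInstanceAs (AddCommGroup (ι → ℤ))

/-- `Λ` acts through the ring homomorphism `Λ → ℤ`, `t ↦ 1`. -/
instance TrivialModule.instModule (ι : Type*) : Module ℤ[T;T⁻¹] (TrivialModule ι) :=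
  letI : Module ℤ (TrivialModule ι) := inferInstanceAs (Module ℤ (ι → ℤ))
  Module.compHom (TrivialModule ι) (LaurentPolynomial.eval₂ (RingHom.id ℤ) (1 : ℤˣ))

theorem TrivialModule.t_smul {ι : Type*} (v : TrivialModule ι) : tΛ • v = v := by
  let _ : Module ℤ (TrivialModule ι) := inferInstanceAs (Module ℤ (ι → ℤ))
  change (LaurentPolynomial.eval₂ (RingHom.id ℤ) (1 : ℤˣ) tΛ : ℤ) • v = v
  simp [tΛ]

/-! ## Oriented link diagrams

A diagram of an oriented virtual link, up to planar isotopy and detour moves, is recorded by its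
(signed, oriented) Gauss data: the classical crossings, their signs, and the order in which the
components run through the crossings. -/

/-- The Gauss data of a diagram, with classical crossings `Crossing`, of an oriented virtual link
with components indexed by `Fin μ`.

Each crossing `c` is passed twice: `(c, true)` is the overpass at `c`, and `(c, false)` is the
underpass at `c`. -/
structure LinkDiagram (μ : ℕ) where
  /-- the set of classical crossings -/
  Crossing : Type
  finite_crossing : Finite Crossing
  /-- the writhe of a crossing -/
  writhe : Crossing → ℤˣ
  /-- the passage which follows a given one along the oriented component -/
  next : Equiv.Perm (Crossing × Bool)
  /-- the component to which a passage belongs -/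
  comp : Crossing × Bool → Fin μ
  /-- Two passages belong to the same component if and only if one is reached from the other by
  walking along the component. Indices outside the range of `comp` belong to components without
  classical crossings. -/
  comp_eq_iff : ∀ p q, comp p = comp q ↔ next.SameCycle p q

namespace LinkDiagram

variable {μ : ℕ} (D : LinkDiagram μ)

/-- The passages of the components through the classical crossings. -/
abbrev Passage : Type := D.Crossing × Bool

/-- The pieces into which the passages cut the components: `Sum.inl p` is the segment from the
passage `p` to the passage `D.next p`, and `Sum.inr i` is the closed curve given by a
component without classical crossings. -/
abbrev Segment : Type := D.Passage ⊕ {i : Fin μ // ∀ p, D.comp p ≠ i}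

/-- The two segments which meet at an overpass belong to the same arc. -/
inductive OverRel : D.Segment → D.Segment → Prop where
  | joins (c : D.Crossing) : OverRel (.inl (D.next.symm (c, true))) (.inl (c, true))

/-- The set `A(D)` of (long) arcs: the components are cut at the underpasses only. -/
def Arc : Type := Quot D.OverRel

/-- The arc containing a segment. -/
def arc (s : D.Segment) : D.Arc := Quot.mk _ s

/-- The component to which a segment belongs. -/
def segmentComp : D.Segment → Fin μ
  | .inl p => D.comp p
  | .inr i => i.1

/-- `κ_D : A(D) → {1, …, μ}`, the component to which an arc belongs. -/
def κ : D.Arc → Fin μ :=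
  Quot.lift D.segmentComp (by
    rintro _ _ ⟨c⟩
    refine (D.comp_eq_iff _ _).2 ⟨1, ?_⟩
    simp)

/-- The overpassing arc `a(c)`. -/
def overArc (c : D.Crossing) : D.Arc := D.arc (.inl (c, true))

/-- The underpassing arc which ends at `c`. -/
def underIn (c : D.Crossing) : D.Arc := D.arc (.inl (D.next.symm (c, false)))

/-- The underpassing arc which starts at `c`. -/
def underOut (c : D.Crossing) : D.Arc := D.arc (.inl (c, false))

/-- The underpassing arc `b₁(c)` on the right of the overpassing arc. At a crossing of writhe
`1` the underpass runs from the right to the left of the overpass. -/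
def b₁ (c : D.Crossing) : D.Arc := if D.writhe c = 1 then D.underIn c else D.underOut c

/-- The underpassing arc `b₂(c)` on the left of the overpassing arc. -/
def b₂ (c : D.Crossing) : D.Arc := if D.writhe c = 1 then D.underOut c else D.underIn c

/-! ### Classical diagrams

The Gauss data are those of a diagram in the plane without virtual crossings if and only if the
4-valent ribbon graph which they describe has genus 0. -/

/-- The half-edges at the crossings: `(p, true)` is the half-edge on which the passage `p` leaves
the crossing, `(p, false)` the one on which it arrives. -/
abbrev HalfEdge : Type := D.Passage × Bool

/-- The permutation taking a half-edge to its other end. -/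
def flip : Equiv.Perm D.HalfEdge where
  toFun
    | (p, true) => (D.next p, false)
    | (p, false) => (D.next.symm p, true)
  invFun
    | (p, true) => (D.next p, false)
    | (p, false) => (D.next.symm p, true)
  left_inv := by rintro ⟨p, _ | _⟩ <;> simp
  right_inv := by rintro ⟨p, _ | _⟩ <;> simp

/-- The permutation taking a half-edge to its counterclockwise neighbour at the same crossing. The
counterclockwise cyclic order is (over out, under out, over in, under in) if the
writhe is `1`, and (over out, under in, over in, under out) if the writhe is `-1`. -/
def rotate : Equiv.Perm D.HalfEdge where
  toFun
    | ((c, true), x) => ((c, false), if D.writhe c = 1 then x else !x)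
    | ((c, false), x) => ((c, true), if D.writhe c = 1 then !x else x)
  invFun
    | ((c, false), x) => ((c, true), if D.writhe c = 1 then x else !x)
    | ((c, true), x) => ((c, false), if D.writhe c = 1 then !x else x)
  left_inv := by rintro ⟨⟨c, _ | _⟩, x⟩ <;> by_cases h : D.writhe c = 1 <;> simp [h]
  right_inv := by rintro ⟨⟨c, _ | _⟩, x⟩ <;> by_cases h : D.writhe c = 1 <;> simp [h]

/-- The faces: the orbits of the permutation which follows an edge to its other end and then
turns to the next half-edge. -/
def Face : Type := Quotient (Equiv.Perm.SameCycle.setoid (D.rotate * D.flip))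

/-- The crossings `c` and `d` are joined by a segment from `c` to `d`. -/
def Joined (c d : D.Crossing) : Prop := ∃ p : D.Passage, p.1 = c ∧ (D.next p).1 = d

/-- The connected components of the 4-valent graph formed by the crossings and the segments
between them. -/
def Piece : Type := Quot D.Joined

/-- `D` is a classical (planar) diagram: Euler's formula `V - E + F = 2 k` of genus 0 holds, where
`k` is the number of connected components of the 4-valent graph. -/
def IsClassical : Prop :=
  Nat.card D.Crossing + Nat.card D.Face = Nat.card D.Passage + 2 * Nat.card D.Piece

/-! ### The medial quandle and the involutory medial quandle -/

/-- The relations `q_{b₂(c)} = q_{b₁(c)} ▷ q_{a(c)}`. -/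
inductive CrossingRel : QuandleWord D.Arc → QuandleWord D.Arc → Prop where
  | crossing (c : D.Crossing) :
      CrossingRel (.gen (D.b₂ c)) (.act (.gen (D.overArc c)) (.gen (D.b₁ c)))

/-- The medial quandle `MQ(L)`. -/
abbrev MQ : Type := PresentedQuandle (QuandleWord.MedialRel D.CrossingRel)

/-- The involutory medial quandle `IMQ(L)`, the involutory quotient of `MQ(L)`. -/
abbrev IMQ : Type := InvolutoryQuotient D.MQ

/-! ### The reduced Alexander module -/

/-- `ϱ_D(c) = (1 - t) a(c) + t b₁(c) - b₂(c)`. -/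
def ρ : (D.Crossing →₀ ℤ[T;T⁻¹]) →ₗ[ℤ[T;T⁻¹]] (D.Arc →₀ ℤ[T;T⁻¹]) :=
  Finsupp.linearCombination ℤ[T;T⁻¹] fun c =>
    Finsupp.single (D.overArc c) (1 - tΛ) + Finsupp.single (D.b₁ c) tΛ - Finsupp.single (D.b₂ c) 1

/-- The reduced Alexander module `M_A^red(L)`, the cokernel of `ϱ_D`. -/
abbrev MAred : Type := (D.Arc →₀ ℤ[T;T⁻¹]) ⧸ LinearMap.range D.ρ

/-- `ς_D(a)`, the generator of the reduced Alexander module given by an arc. -/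
def ς (a : D.Arc) : D.MAred := Submodule.Quotient.mk (Finsupp.single a 1)

theorem κ_b (c : D.Crossing) : D.κ (D.b₁ c) = D.κ (D.b₂ c) := by
  have h : D.κ (D.underIn c) = D.κ (D.underOut c) := by
    refine (D.comp_eq_iff _ _).2 ⟨1, ?_⟩
    simp
  unfold b₁ b₂
  split_ifs
  exacts [h, h.symm]

/-- The image `(1, 0, …, 1, …, 0)` of an arc in `A_μ = Λ ⊕ ℤ ^ (μ - 1)`. The coordinates of the
second summand are indexed by the components other than the first one. -/
def arcValue (a : D.Arc) : ℤ[T;T⁻¹] × TrivialModule {j : Fin μ // (j : ℕ) ≠ 0} :=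
  (1, fun j => if D.κ a = j.1 then 1 else 0)

/-- The map `φ_τ : M_A^red(L) → A_μ`. -/
def φτ : D.MAred →ₗ[ℤ[T;T⁻¹]] ℤ[T;T⁻¹] × TrivialModule {j : Fin μ // (j : ℕ) ≠ 0} :=
  (LinearMap.range D.ρ).liftQ (Finsupp.linearCombination ℤ[T;T⁻¹] D.arcValue) (by
    rw [LinearMap.range_le_ker_iff]
    refine Finsupp.lhom_ext' fun c => LinearMap.ext_ring ?_
    have h : D.arcValue (D.b₁ c) = D.arcValue (D.b₂ c) := by
      unfold arcValue
      rw [D.κ_b c]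
    ext1
    · simp [ρ, arcValue]
    · simp [ρ, h, TrivialModule.t_smul])

/-- The map `φ_L^red : M_A^red(L) → Λ`, the first coordinate of `φ_τ`; it takes every arc to
`1`. -/
def φred : D.MAred →ₗ[ℤ[T;T⁻¹]] ℤ[T;T⁻¹] :=
  LinearMap.fst ℤ[T;T⁻¹] ℤ[T;T⁻¹] (TrivialModule {j : Fin μ // (j : ℕ) ≠ 0}) ∘ₗ D.φτ

/-- `x` is a meridian of the `i`th component in the reduced Alexander module. -/
def IsMeridian (i : Fin μ) (x : D.MAred) : Prop :=
  ∃ a : D.Arc, D.κ a = i ∧ D.φτ x = D.φτ (D.ς a)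

theorem φred_ς (a : D.Arc) : D.φred (D.ς a) = 1 := by
  change (D.φτ (Submodule.Quotient.mk (Finsupp.single a 1))).1 = 1
  rw [φτ, ← Submodule.mkQ_apply, Submodule.mkQ_apply, Submodule.liftQ_apply]
  simp [arcValue]

theorem IsMeridian.φred_eq {D : LinkDiagram μ} {i : Fin μ} {x : D.MAred}
    (h : D.IsMeridian i x) : D.φred x = 1 := by
  obtain ⟨a, -, h⟩ := h
  rw [← D.φred_ς a]
  exact congrArg Prod.fst h

/-- The quandle `Q_A^red(L)`, i.e. the union of the cosets `m_i + (1 - t) ker φ_L^red`, where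
`m_i` is a meridian of the `i`th component. It is a subquandle of the standard Alexander quandle
on the reduced Alexander module. -/
def QAred (m : Fin μ → D.MAred) (hm : ∀ i, D.IsMeridian i (m i)) :
    Subquandle (AlexanderQuandle D.MAred) where
  carrier := {x : D.MAred | ∃ i, ∃ n ∈ LinearMap.ker D.φred, x = m i + (1 - tΛ) • n}
  act_mem := by
    rintro _ _ ⟨i, n, hn, rfl⟩ ⟨j, n', hn', rfl⟩
    refine ⟨j, (m i - m j) + tΛ • n' + (1 - tΛ) • n, ?_, ?_⟩
    · rw [LinearMap.mem_ker] at hn hn' ⊢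
      simp [hn, hn', (hm i).φred_eq, (hm j).φred_eq]
    · change tΛ • (m j + (1 - tΛ) • n') + (1 - tΛ) • (m i + (1 - tΛ) • n) = _
      module
  invAct_mem := by
    rintro _ _ ⟨i, n, hn, rfl⟩ ⟨j, n', hn', rfl⟩
    refine ⟨j, tInvΛ • (m j - m i) + tInvΛ • n' + (1 - tInvΛ) • n, ?_, ?_⟩
    · rw [LinearMap.mem_ker] at hn hn' ⊢
      simp [hn, hn', (hm i).φred_eq, (hm j).φred_eq]
    · change tInvΛ • (m j + (1 - tΛ) • n') + (1 - tInvΛ) • (m i + (1 - tΛ) • n) = _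
      have h := tInvΛ_mul_tΛ
      linear_combination (norm := module) h • (m j - m i)

/-- The submodule `(1 + t) M_A^red(L)`. -/
def onePlusT : Submodule ℤ[T;T⁻¹] D.MAred :=
  LinearMap.range (LinearMap.lsmul ℤ[T;T⁻¹] D.MAred (1 + tΛ))

/-- The image of `Q_A^red(L)` in the standard Alexander quandle on the quotient module
`M_A^red(L) / (1 + t) M_A^red(L)`. -/
def QAredImage (m : Fin μ → D.MAred) (hm : ∀ i, D.IsMeridian i (m i)) :
    Subquandle (AlexanderQuandle (D.MAred ⧸ D.onePlusT)) :=
  (D.QAred m hm).map (AlexanderQuandle.map D.onePlusT.mkQ)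

end LinkDiagram

end

/-! On `M_A^red/(1+t)` the quandle operation is `x ◃ y = 2x - y`, so arcs ↦ generators extends to a
homomorphism `imqHom` from IMQ; the task is to identify its image and prove it injective.

Mediality and involutivity make the products of translations `s_a s_{a₀}` commute, so the free
abelian group on the arcs acts on IMQ (`exists_isDisplacement`). Every element lies in the orbit of
an arc generator, relators at `t = -1` act trivially, and `v` changes the value in the module by
twice the class of `subBase a₀ v` (`imqValue_apply`). For surjectivity it remains to know that `ker
φτ = (1-t) ker φred`, so that the chosen meridians do not matter.

For injectivity, equal values first force equal components, by a parity count. The question becomes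
whether `v` fixes `q_a` whenever `2v = ∑ r_c rel_c`. This is subtle because the module may have
2-torsion. Modulo 2 the coefficients `r_c` are constant along the underpasses of each component
(`cast_eq_cast_of_two_smul_eq`). The relators of one component sum to twice the displacement
`componentShift` picked up by walking once around it, and that displacement fixes `q_a` for arcs `a`
of the component. A classical diagram has a checkerboard colouring, which gives a vanishing
combination of all relators with odd coefficients. With at most two components, this makes `r_c`
even off the component of `a`. Dividing by 2 writes `v` as a multiple of `componentShift` plus
relators, and both fix `q_a`. -/

noncomputable section

/-! ### Presented quandles and involutory quotients -/

/-- The value of a word in a quandle, given the values of the generators. -/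
def QuandleWord.eval {X Q : Type*} [Quandle Q] (g : X → Q) : QuandleWord X → Q
  | .gen x => g x
  | .act a b => QuandleWord.eval g a ◃ QuandleWord.eval g b
  | .invAct a b => QuandleWord.eval g a ◃⁻¹ QuandleWord.eval g b

theorem QuandleWord.Congr.eval_eq {X Q : Type*} [Quandle Q]
    {R : QuandleWord X → QuandleWord X → Prop}
    (g : X → Q) (h : ∀ a b, R a b → a.eval g = b.eval g) {a b : QuandleWord X}
    (hab : QuandleWord.Congr R a b) : a.eval g = b.eval g := by
  induction hab with
  | of h' => exact h _ _ h'
  | refl => rfl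
  | symm _ ih => exact ih.symm
  | trans _ _ ih ih' => exact ih.trans ih'
  | act _ _ ih ih' => simp only [QuandleWord.eval, ih, ih']
  | invAct _ _ ih ih' => simp only [QuandleWord.eval, ih, ih']
  | self_distrib => exact Shelf.self_distrib
  | left_inv => exact Rack.left_inv _ _
  | right_inv => exact Rack.right_inv _ _
  | fix => exact Quandle.fix

namespace PresentedQuandle

variable {X : Type*} {R : QuandleWord X → QuandleWord X → Prop}

/-- The element of a presented quandle given by a word. -/
def mk (R : QuandleWord X → QuandleWord X → Prop) (w : QuandleWord X) : PresentedQuandle R :=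
  Quotient.mk (QuandleWord.congrSetoid R) w

theorem mk_eq_of_rel {a b : QuandleWord X} (h : R a b) : mk R a = mk R b :=
  Quotient.sound (.of h)

theorem mk_surjective : Function.Surjective (mk R) := Quotient.exists_rep

/-- The homomorphism from a presented quandle given by images of the generators which satisfy the
relations. -/
def lift {Q : Type*} [Quandle Q] (g : X → Q) (h : ∀ a b, R a b → a.eval g = b.eval g) :
    PresentedQuandle R →◃ Q where
  toFun := Quotient.lift (QuandleWord.eval g) fun _ _ hab => QuandleWord.Congr.eval_eq g h hab
  map_act' := by
    rintro ⟨a⟩ ⟨b⟩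
    rfl

theorem induction {P : PresentedQuandle R → Prop} (hgen : ∀ x, P (mk R (.gen x)))
    (hact : ∀ x y, P x → P y → P (x ◃ y)) (hinv : ∀ x y, P x → P y → P (x ◃⁻¹ y)) (x) : P x := by
  obtain ⟨w, rfl⟩ := mk_surjective x
  induction w with
  | gen x => exact hgen x
  | act a b iha ihb => exact hact _ _ iha ihb
  | invAct a b iha ihb => exact hinv _ _ iha ihb

end PresentedQuandle

theorem PresentedQuandle.medial {X : Type*} {R : QuandleWord X → QuandleWord X → Prop}
    (w x y z : PresentedQuandle (QuandleWord.MedialRel R)) :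
    (z ◃ y) ◃ (x ◃ w) = (z ◃ x) ◃ (y ◃ w) := by
  obtain ⟨w, rfl⟩ := mk_surjective w
  obtain ⟨x, rfl⟩ := mk_surjective x
  obtain ⟨y, rfl⟩ := mk_surjective y
  obtain ⟨z, rfl⟩ := mk_surjective z
  exact mk_eq_of_rel (.medial w x y z)

namespace InvolutoryQuotient

variable {Q : Type*} [Quandle Q]

/-- The canonical homomorphism to the involutory quotient. -/
def proj (Q : Type*) [Quandle Q] : Q →◃ InvolutoryQuotient Q where
  toFun x := PresentedQuandle.mk _ (.gen x)
  map_act' := by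
    intro x y
    exact (PresentedQuandle.mk_eq_of_rel (.op y x)).symm

theorem proj_surjective : Function.Surjective (proj Q) := by
  intro x
  induction x using PresentedQuandle.induction with
  | hgen x => exact ⟨x, rfl⟩
  | hact x y hx hy =>
    obtain ⟨x, rfl⟩ := hx
    obtain ⟨y, rfl⟩ := hy
    exact ⟨x ◃ y, (proj Q).map_act⟩
  | hinv x y hx hy =>
    obtain ⟨x, rfl⟩ := hx
    obtain ⟨y, rfl⟩ := hy
    exact ⟨x ◃⁻¹ y, (proj Q).map_invAct_quandle x y⟩

theorem act_act (x y : InvolutoryQuotient Q) : x ◃ (x ◃ y) = y := by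
  obtain ⟨x, rfl⟩ := proj_surjective x
  obtain ⟨y, rfl⟩ := proj_surjective y
  rw [← (proj Q).map_act, ← (proj Q).map_act]
  exact PresentedQuandle.mk_eq_of_rel (.invol y x)

end InvolutoryQuotient

/-! ### Translations of involutory medial quandles -/

/-- A family of commuting elements of a group defines a homomorphism from the free abelian group
on the index set. -/
theorem exists_finsupp_hom_of_commute {A P : Type*} [Group P] (f : A → P)
    (hf : ∀ a b, f a * f b = f b * f a) :
    ∃ G : Multiplicative (A →₀ ℤ) →* P,
      ∀ a, G (Multiplicative.ofAdd (Finsupp.single a 1)) = f a := by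
  have : IsMulCommutative (Subgroup.closure (Set.range f)) :=
    Subgroup.isMulCommutative_closure (by
      rintro _ ⟨a, rfl⟩ _ ⟨b, rfl⟩
      exact hf a b)
  let _ : CommGroup (Subgroup.closure (Set.range f)) :=
    { (inferInstance : Group (Subgroup.closure (Set.range f))) with
      mul_comm := IsMulCommutative.is_comm.comm }
  let e (a : A) : Additive (Subgroup.closure (Set.range f)) :=
    Additive.ofMul ⟨f a, Subgroup.subset_closure ⟨a, rfl⟩⟩
  let G₀ : (A →₀ ℤ) →+ Additive (Subgroup.closure (Set.range f)) :=
    Finsupp.liftAddHom fun a => zmultiplesHom _ (e a)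
  refine ⟨(Subgroup.subtype _).comp (AddMonoidHom.toMultiplicativeLeft G₀), fun a => ?_⟩
  have h : G₀ (Finsupp.single a 1) = e a := by simp [G₀]
  change ((G₀ (Finsupp.single a 1)).toMul : P) = f a
  rw [h]
  rfl

section InvolutoryMedial

variable {Q : Type*} [Quandle Q]

theorem Rack.act'_inv_of_involutory (hinv : ∀ x y : Q, x ◃ (x ◃ y) = y) (x : Q) :
    (Rack.act' x)⁻¹ = Rack.act' x := by
  rw [inv_eq_iff_mul_eq_one]
  ext y
  exact hinv x y

/-- Mediality equates two products of translations. Writing the translation by `y ◃ x` as a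
conjugate and cancelling the outer `y` leaves the swap of the two ends. -/
theorem Rack.act'_swap_of_medial (hinv : ∀ x y : Q, x ◃ (x ◃ y) = y)
    (hmed : ∀ w x y z : Q, (z ◃ y) ◃ (x ◃ w) = (z ◃ x) ◃ (y ◃ w)) (x y z : Q) :
    Rack.act' x * Rack.act' y * Rack.act' z = Rack.act' z * Rack.act' y * Rack.act' x := by
  have h : Rack.act' (y ◃ x) * Rack.act' z = Rack.act' (y ◃ z) * Rack.act' x := by
    ext w
    exact hmed w z x y
  rw [Rack.ad_conj, Rack.ad_conj, Rack.act'_inv_of_involutory hinv] at h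
  simpa [mul_assoc] using h

end InvolutoryMedial

/-! ### Planarity and checkerboard colourings -/

theorem finrank_fun_eq_natCard (X : Type*) [Finite X] (K : Type*) [Field K] :
    Module.finrank K (X → K) = Nat.card X := by
  have := Fintype.ofFinite X
  rw [Module.finrank_fintype_fun_eq_card, Nat.card_eq_fintype_card]

/-- The rank of a linear map from a function space all of whose kernel elements factor through `g`
is at least the difference of the cardinalities. -/
theorem natCard_le_finrank_range_add {X Y K V : Type*} [Finite X] [Finite Y] [Field K]
    [AddCommGroup V] [Module K V] (g : X → Y) (d : (X → K) →ₗ[K] V)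
    (h : LinearMap.ker d ≤ LinearMap.range (LinearMap.funLeft K K g)) :
    Nat.card X ≤ Module.finrank K (LinearMap.range d) + Nat.card Y := by
  have h₁ := LinearMap.finrank_range_add_finrank_ker d
  have h₂ := Submodule.finrank_mono h
  have h₃ := LinearMap.finrank_range_le (LinearMap.funLeft K K g)
  rw [finrank_fun_eq_natCard] at h₁ h₃
  lia

namespace LinkDiagram

variable {μ : ℕ} (D : LinkDiagram μ)

instance instFiniteCrossing : Finite D.Crossing := D.finite_crossing

instance instFiniteFace : Finite D.Face := Quotient.finite _

instance instFinitePiece : Finite D.Piece := Quot.finite _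

instance instFintypeCrossing : Fintype D.Crossing := Fintype.ofFinite _

/-- The face on the right of an oriented edge which starts at the given half-edge. -/
def face (h : D.HalfEdge) : D.Face := Quotient.mk _ h

theorem flip_flip (h : D.HalfEdge) : D.flip (D.flip h) = h := by
  obtain ⟨p, _ | _⟩ := h <;> simp [flip]

/-- Since `flip` is an involution, `rotate h` is the successor of `flip h` under the permutation
whose orbits are the faces. -/
theorem face_rotate (h : D.HalfEdge) : D.face (D.rotate h) = D.face (D.flip h) := by
  refine Quotient.sound (Equiv.Perm.SameCycle.symm ⟨1, ?_⟩)
  simp [flip_flip]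

theorem rotate_crossing (h : D.HalfEdge) : (D.rotate h).1.1 = h.1.1 := by
  obtain ⟨⟨c, _ | _⟩, x⟩ := h <;> rfl

theorem rotate_rotate (p : D.Passage) (x : Bool) : D.rotate (D.rotate (p, x)) = (p, !x) := by
  obtain ⟨c, _ | _⟩ := p <;> by_cases h : D.writhe c = 1 <;> simp [rotate, h]

/-- A function on half-edges which is invariant under rotation depends on the crossing only. -/
theorem eq_of_rotate_invariant {Y : Type*} (f : D.HalfEdge → Y)
    (hf : ∀ h, f (D.rotate h) = f h) (h : D.HalfEdge) : f h = f ((h.1.1, true), true) := by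
  have h₂ (p : D.Passage) (x : Bool) : f (p, x) = f (p, true) := by
    cases x
    · rw [← hf (p, false), ← hf (D.rotate _), rotate_rotate]
      rfl
    · rfl
  obtain ⟨⟨c, b⟩, x⟩ := h
  rw [h₂]
  cases b
  · rw [← hf ((c, false), true)]
    exact h₂ (c, true) _
  · rfl

/-- The coboundary of a function on the set of crossings, as a functional on the functions on the
set of edges. -/
def crossingCoboundary :
    (D.Crossing → ZMod 2) →ₗ[ZMod 2] Module.Dual (ZMod 2) (D.Passage → ZMod 2) where
  toFun f := ∑ p : D.Passage, (f p.1 + f (D.next p).1) • LinearMap.proj p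
  map_add' f g := by
    rw [← Finset.sum_add_distrib]
    refine Finset.sum_congr rfl fun p _ => ?_
    rw [← add_smul]
    congr 1
    simp only [Pi.add_apply]
    ring
  map_smul' a f := by
    simp [Finset.smul_sum, ← mul_smul, mul_add]

theorem crossingCoboundary_apply (f : D.Crossing → ZMod 2) (g : D.Passage → ZMod 2) :
    D.crossingCoboundary f g = ∑ p : D.Passage, (f p.1 + f (D.next p).1) * g p := by
  simp [crossingCoboundary]

/-- The boundary of a function on the set of faces. -/
def faceBoundary : (D.Face → ZMod 2) →ₗ[ZMod 2] (D.Passage → ZMod 2) :=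
  LinearMap.funLeft _ _ (fun p => D.face (p, true)) +
    LinearMap.funLeft _ _ (fun p => D.face (D.flip (p, true)))

theorem faceBoundary_apply (φ : D.Face → ZMod 2) (p : D.Passage) :
    D.faceBoundary φ p = φ (D.face (p, true)) + φ (D.face (D.flip (p, true))) := rfl

theorem sum_halfEdge {Y : Type*} [AddCommMonoid Y] (f : D.HalfEdge → Y) :
    ∑ h, f h = ∑ p : D.Passage, (f (p, true) + f (D.flip (p, true))) := by
  rw [Fintype.sum_prod_type]
  simp only [Fintype.sum_bool, Finset.sum_add_distrib]
  congr 1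
  exact (Equiv.sum_comp D.next fun p => f (p, false)).symm

/-- Expanded over half-edges, the pairing is a sum of two terms, one weighted by the face at `h` and
one by the face at `flip h`. Rotation about crossings carries one into the other, so they cancel
modulo 2. -/
theorem crossingCoboundary_faceBoundary (f : D.Crossing → ZMod 2) (φ : D.Face → ZMod 2) :
    D.crossingCoboundary f (D.faceBoundary φ) = 0 := by
  let F (h : D.HalfEdge) : ZMod 2 := f h.1.1
  let Φ (h : D.HalfEdge) : ZMod 2 := φ (D.face h)
  have h₁ : D.crossingCoboundary f (D.faceBoundary φ) =
      ∑ h, Φ h * F h + ∑ h, Φ (D.flip h) * F h := by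
    rw [crossingCoboundary_apply, sum_halfEdge, sum_halfEdge, ← Finset.sum_add_distrib]
    refine Finset.sum_congr rfl fun p _ => ?_
    rw [faceBoundary_apply, flip_flip]
    change (F (p, true) + F (D.flip (p, true))) * (Φ (p, true) + Φ (D.flip (p, true))) = _
    ring
  have h₂ : ∑ h, Φ (D.flip h) * F h = ∑ h, Φ h * F h := by
    rw [← Equiv.sum_comp D.rotate fun h => Φ h * F h]
    refine Finset.sum_congr rfl fun h _ => ?_
    simp only [Φ, F, face_rotate, rotate_crossing]
  rw [h₁, h₂, CharTwo.add_self_eq_zero]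

/-- A face function with zero boundary takes equal values on both sides of every edge, hence at all
corners of a crossing, hence throughout a connected piece. So the kernel has dimension at most the
number of pieces. -/
theorem natCard_face_le :
    Nat.card D.Face ≤
      Module.finrank (ZMod 2) (LinearMap.range D.faceBoundary) + Nat.card D.Piece := by
  have hflip (φ : D.Face → ZMod 2) (hφ : φ ∈ LinearMap.ker D.faceBoundary) (h : D.HalfEdge) :
      φ (D.face (D.flip h)) = φ (D.face h) := by
    have key (p : D.Passage) : φ (D.face (p, true)) = φ (D.face (D.flip (p, true))) := by
      rw [← CharTwo.add_eq_zero, ← faceBoundary_apply, LinearMap.mem_ker.1 hφ]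
      rfl
    obtain ⟨p, _ | _⟩ := h
    · refine (key (D.next.symm p)).trans ?_
      simp [flip]
    · exact (key p).symm
  have hφ' (φ : D.Face → ZMod 2) (hφ : φ ∈ LinearMap.ker D.faceBoundary) (h : D.HalfEdge) :
      φ (D.face h) = φ (D.face ((h.1.1, true), true)) := by
    refine D.eq_of_rotate_invariant (fun h => φ (D.face h)) (fun h => ?_) h
    rw [face_rotate, hflip φ hφ]
  let g (x : D.Face) : D.Piece := Quot.mk _ x.out.1.1
  refine natCard_le_finrank_range_add g D.faceBoundary fun φ hφ => ?_
  refine ⟨Quot.lift (fun c => φ (D.face ((c, true), true))) ?_, ?_⟩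
  · rintro _ _ ⟨p, rfl, rfl⟩
    rw [← hφ' φ hφ (p, true), ← hflip φ hφ, hφ' φ hφ]
    rfl
  · ext x
    change φ (D.face ((x.out.1.1, true), true)) = φ x
    rw [← hφ' φ hφ]
    exact congrArg φ (Quotient.out_eq x)

theorem natCard_crossing_le :
    Nat.card D.Crossing ≤
      Module.finrank (ZMod 2) (LinearMap.range D.crossingCoboundary) + Nat.card D.Piece := by
  classical
  refine natCard_le_finrank_range_add (Quot.mk D.Joined) D.crossingCoboundary fun f hf => ?_
  refine ⟨Quot.lift f ?_, rfl⟩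
  rintro _ _ ⟨p, rfl, rfl⟩
  -- Evaluating on the indicator of one edge shows that `f` agrees at its two ends.
  have h := congrArg (fun L => L (Pi.single p 1)) (LinearMap.mem_ker.1 hf)
  simpa [crossingCoboundary_apply, Pi.single_apply, CharTwo.add_eq_zero] using h

/-- The faces of a classical diagram admit a checkerboard colouring. -/
theorem IsClassical.exists_checkerboard {D : LinkDiagram μ} (hD : D.IsClassical) :
    ∃ φ : D.Face → ZMod 2, D.faceBoundary φ = 1 := by
  change 1 ∈ LinearMap.range D.faceBoundary
  rw [← Subspace.forall_mem_dualAnnihilator_apply_eq_zero_iff]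
  have hle : LinearMap.range D.crossingCoboundary ≤
      (LinearMap.range D.faceBoundary).dualAnnihilator := by
    rintro _ ⟨f, rfl⟩
    rw [Submodule.mem_dualAnnihilator]
    rintro _ ⟨φ, rfl⟩
    exact D.crossingCoboundary_faceBoundary f φ
  -- With `k` pieces, the rank bounds `V - k` and `F - k` together with Euler's formula `V + F = E +
  -- 2k` leave no room between the cuts and the annihilator of the face boundaries.
  have heq := Submodule.eq_of_le_of_finrank_le hle (by
    have h₁ := Subspace.finrank_add_finrank_dualAnnihilator_eq (LinearMap.range D.faceBoundary)
    rw [finrank_fun_eq_natCard] at h₁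
    have h₂ := D.natCard_face_le
    have h₃ := D.natCard_crossing_le
    unfold IsClassical at hD
    lia)
  rw [← heq]
  rintro _ ⟨f, rfl⟩
  rw [crossingCoboundary_apply]
  simp only [Pi.one_apply, mul_one, Finset.sum_add_distrib]
  -- Initial and final ends of edges contribute equally, because `next` permutes the passages.
  rw [Equiv.sum_comp D.next fun p => f p.1, CharTwo.add_self_eq_zero]

/-- The passages of a classical diagram can be given signs which alternate along the components
and which are opposite for the two passages through a crossing. -/
theorem IsClassical.exists_alternating {D : LinkDiagram μ} (hD : D.IsClassical) :
    ∃ ℓ : D.Passage → ℤ, (∀ p, ℓ p = 1 ∨ ℓ p = -1) ∧ (∀ p, ℓ (D.next p) = -ℓ p) ∧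
      ∀ c, ℓ (c, false) = -ℓ (c, true) := by
  obtain ⟨φ, hφ⟩ := hD.exists_checkerboard
  -- Changing sides of an edge changes the colour. So does a quarter turn at a crossing, while a
  -- half turn, which stays on the same passage, preserves it.
  have hflip (h : D.HalfEdge) : φ (D.face (D.flip h)) = φ (D.face h) + 1 := by
    have key (p : D.Passage) : φ (D.face (p, true)) + φ (D.face (D.flip (p, true))) = 1 :=
      congrFun hφ p
    obtain ⟨p, _ | _⟩ := h
    · have := key (D.next.symm p)
      rw [show D.flip (D.next.symm p, true) = (p, false) by simp [flip]] at this
      rw [← this]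
      change φ (D.face (D.next.symm p, true)) = _
      grind
    · grind
  have hrot (h : D.HalfEdge) : φ (D.face (D.rotate h)) = φ (D.face h) + 1 := by
    rw [face_rotate, hflip]
  have hneg (p : D.Passage) (x : Bool) : φ (D.face (p, !x)) = φ (D.face (p, x)) := by
    rw [← rotate_rotate, hrot, hrot]
    grind
  have hbool (p : D.Passage) (x : Bool) : φ (D.face (p, x)) = φ (D.face (p, true)) := by
    cases x
    · exact hneg p true
    · rfl
  let s (z : ZMod 2) : ℤ := if z = 0 then 1 else -1
  have hs : ∀ z, s (z + 1) = -s z := by decide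
  refine ⟨fun p => s (φ (D.face (p, true))), fun p => ?_, fun p => ?_, fun c => ?_⟩
  · by_cases h : φ (D.face (p, true)) = 0 <;> simp [s, h]
  · beta_reduce
    rw [← hbool (D.next p) false, ← hs, ← hflip]
    rfl
  · beta_reduce
    rw [← hs, ← hrot]
    exact congrArg s (hbool (c, false) _).symm

end LinkDiagram

/-! ### Specialisation at `t = -1` -/

/-- The remainder theorem, needed at `u = -1` for the quotient by `1 + t` and at `u = 1` for the
kernel of `φτ`. -/
theorem LaurentPolynomial.exists_sub_C_eval₂_eq_mul {R : Type*} [CommRing R] (u : Rˣ) (f : R[T;T⁻¹]) :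
    ∃ h, f - C (eval₂ (RingHom.id R) u f) = (T 1 - C (u : R)) * h := by
  have hu : (C (u : R) : R[T;T⁻¹]) * C ((u⁻¹ : Rˣ) : R) = 1 := by
    rw [← map_mul, Units.mul_inv, map_one]
  have hT : (T 1 : R[T;T⁻¹]) * T (-1) = 1 := by
    rw [← T_add]
    simp
  induction f using LaurentPolynomial.induction_on with
  | h_C a => exact ⟨0, by simp⟩
  | h_add hp hq =>
    obtain ⟨h, hh⟩ := hp
    obtain ⟨k, hk⟩ := hq
    refine ⟨h + k, ?_⟩
    rw [map_add, map_add]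
    linear_combination hh + hk
  | h_C_mul_T n a ih =>
    obtain ⟨h, hh⟩ := ih
    refine ⟨T 1 * h + C (a * (u ^ (n : ℤ) : Rˣ)), ?_⟩
    simp only [map_mul, eval₂_C, eval₂_T, RingHom.id_apply, T_add, zpow_one] at hh ⊢
    linear_combination T 1 * hh
  | h_C_mul_T_Z n a ih =>
    obtain ⟨h, hh⟩ := ih
    -- The correction term comes from `T⁻¹ - u⁻¹ = -(T - u) T⁻¹ u⁻¹`.
    refine ⟨T (-1) * h - C (a * (u ^ (-n : ℤ) : Rˣ)) * T (-1) * C ((u⁻¹ : Rˣ) : R), ?_⟩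
    simp only [map_mul, eval₂_C, eval₂_T, RingHom.id_apply, sub_eq_add_neg, T_add,
      zpow_neg_one] at hh ⊢
    linear_combination T (-1) * hh +
      C a * C ((u ^ (-n : ℤ) : Rˣ) : R) * (C ((u⁻¹ : Rˣ) : R) * hT - T (-1) * hu)

/-- The evaluation of Laurent polynomials at `t = -1`. -/
def evalNegOne : ℤ[T;T⁻¹] →+* ℤ := LaurentPolynomial.eval₂ (RingHom.id ℤ) (-1)

@[simp]
theorem evalNegOne_t : evalNegOne tΛ = -1 := by simp [evalNegOne]

@[simp]
theorem evalNegOne_C (a : ℤ) : evalNegOne (LaurentPolynomial.C a) = a := by simp [evalNegOne]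

theorem smul_eq_evalNegOne_smul {N : Type*} [AddCommGroup N] [Module ℤ[T;T⁻¹] N]
    (hN : ∀ x : N, tΛ • x = -x) (f : ℤ[T;T⁻¹]) (x : N) : f • x = evalNegOne f • x := by
  obtain ⟨h, hh⟩ := LaurentPolynomial.exists_sub_C_eval₂_eq_mul (-1) f
  have h₀ : (tΛ - LaurentPolynomial.C ((-1 : ℤˣ) : ℤ)) • h • x = 0 := by
    rw [sub_smul, hN]
    simp
  rw [← mul_smul, ← hh, sub_smul, sub_eq_zero] at h₀
  rw [h₀]
  change (LaurentPolynomial.C (evalNegOne f)) • x = _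
  rw [eq_intCast, Int.cast_smul_eq_zsmul]

/-- The coefficientwise evaluation at `t = -1`. -/
def finsuppEvalNegOne (A : Type*) : (A →₀ ℤ[T;T⁻¹]) →+ (A →₀ ℤ) :=
  Finsupp.mapRange.addMonoidHom evalNegOne.toAddMonoidHom

theorem finsuppEvalNegOne_apply {A : Type*} (f : A →₀ ℤ[T;T⁻¹]) (a : A) :
    finsuppEvalNegOne A f a = evalNegOne (f a) := rfl

@[simp]
theorem finsuppEvalNegOne_single {A : Type*} (a : A) (f : ℤ[T;T⁻¹]) :
    finsuppEvalNegOne A (Finsupp.single a f) = Finsupp.single a (evalNegOne f) := by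
  simp [finsuppEvalNegOne]

theorem finsuppEvalNegOne_smul {A : Type*} (f : ℤ[T;T⁻¹]) (g : A →₀ ℤ[T;T⁻¹]) :
    finsuppEvalNegOne A (f • g) = evalNegOne f • finsuppEvalNegOne A g := by
  ext a
  simp [finsuppEvalNegOne_apply]

namespace LinkDiagram

variable {μ : ℕ} (D : LinkDiagram μ)

/-- The quotient `M_A^red(L) / (1 + t) M_A^red(L)`. -/
abbrev MAredNegOne : Type := D.MAred ⧸ D.onePlusT

theorem t_smul_MAredNegOne (x : D.MAredNegOne) : tΛ • x = -x := by
  obtain ⟨x, rfl⟩ := D.onePlusT.mkQ_surjective x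
  rw [eq_neg_iff_add_eq_zero, ← map_smul, ← map_add, Submodule.mkQ_apply,
    Submodule.Quotient.mk_eq_zero]
  refine ⟨x, ?_⟩
  rw [LinearMap.lsmul_apply]
  module

/-- The generator of `M_A^red(L) / (1 + t) M_A^red(L)` given by an arc. -/
def ςNegOne (a : D.Arc) : D.MAredNegOne := D.onePlusT.mkQ (D.ς a)

/-- The additive map from the free abelian group on the arcs to
`M_A^red(L) / (1 + t) M_A^red(L)`. -/
def arcSum : (D.Arc →₀ ℤ) →+ D.MAredNegOne :=
  Finsupp.liftAddHom fun a => zmultiplesHom _ (D.ςNegOne a)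

@[simp]
theorem arcSum_single (a : D.Arc) (n : ℤ) :
    D.arcSum (Finsupp.single a n) = n • D.ςNegOne a := by simp [arcSum]

theorem mk_eq_arcSum (f : D.Arc →₀ ℤ[T;T⁻¹]) :
    D.onePlusT.mkQ ((LinearMap.range D.ρ).mkQ f) = D.arcSum (finsuppEvalNegOne _ f) := by
  induction f using Finsupp.induction_linear with
  | zero => simp
  | add f g hf hg => simp only [map_add, hf, hg]
  | single a b =>
    rw [finsuppEvalNegOne_single, arcSum_single,
      ← smul_eq_evalNegOne_smul D.t_smul_MAredNegOne, ςNegOne, ς, ← map_smul,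
      ← Submodule.mkQ_apply, ← map_smul, Finsupp.smul_single, smul_eq_mul, mul_one]

/-- The relator of a crossing at `t = -1`. -/
def relNegOne (c : D.Crossing) : D.Arc →₀ ℤ :=
  2 • Finsupp.single (D.overArc c) 1 - Finsupp.single (D.underIn c) 1 -
    Finsupp.single (D.underOut c) 1

theorem finsuppEvalNegOne_ρ (r : D.Crossing →₀ ℤ[T;T⁻¹]) :
    finsuppEvalNegOne _ (D.ρ r) = ∑ c, evalNegOne (r c) • D.relNegOne c := by
  rw [ρ, Finsupp.linearCombination_apply, Finsupp.sum_fintype _ _ (by simp), map_sum]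
  refine Finset.sum_congr rfl fun c _ => ?_
  rw [finsuppEvalNegOne_smul]
  congr 1
  have h : Finsupp.single (D.overArc c) (2 : ℤ) = 2 • Finsupp.single (D.overArc c) 1 := by simp
  simp only [map_add, map_sub, finsuppEvalNegOne_single, map_one, evalNegOne_t, relNegOne,
    sub_neg_eq_add, one_add_one_eq_two, h, Finsupp.single_neg]
  unfold b₁ b₂
  split_ifs <;> abel

/-- Lifted to constant Laurent coefficients, `v` becomes a combination of relators plus a multiple
of `1 + t`; evaluation at `-1` kills the latter. -/
theorem exists_sum_relNegOne_of_arcSum_eq_zero {v : D.Arc →₀ ℤ} (hv : D.arcSum v = 0) :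
    ∃ r : D.Crossing → ℤ, v = ∑ c, r c • D.relNegOne c := by
  let v' : D.Arc →₀ ℤ[T;T⁻¹] := v.mapRange LaurentPolynomial.C (map_zero _)
  have hv' : finsuppEvalNegOne _ v' = v := by
    ext a
    simp [finsuppEvalNegOne_apply, v']
  rw [← hv', ← mk_eq_arcSum, Submodule.mkQ_apply, Submodule.Quotient.mk_eq_zero] at hv
  obtain ⟨y, hy⟩ := hv
  obtain ⟨w, rfl⟩ := (LinearMap.range D.ρ).mkQ_surjective y
  rw [LinearMap.lsmul_apply, ← map_smul, eq_comm, ← sub_eq_zero, ← map_sub, Submodule.mkQ_apply,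
    Submodule.Quotient.mk_eq_zero] at hy
  obtain ⟨r, hr⟩ := hy
  refine ⟨fun c => evalNegOne (r c), ?_⟩
  rw [← finsuppEvalNegOne_ρ, hr, map_sub, finsuppEvalNegOne_smul, hv']
  simp

/-! ### Meridians and the kernel of `φτ` -/

theorem φτ_ς (a : D.Arc) : D.φτ (D.ς a) = D.arcValue a := by
  rw [φτ, ς, Submodule.liftQ_apply]
  simp

theorem ς_relation (c : D.Crossing) :
    D.ς (D.b₂ c) = (1 - tΛ) • D.ς (D.overArc c) + tΛ • D.ς (D.b₁ c) := by
  have h : (LinearMap.range D.ρ).mkQ (D.ρ (Finsupp.single c 1)) = 0 := by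
    rw [Submodule.mkQ_apply, Submodule.Quotient.mk_eq_zero]
    exact ⟨_, rfl⟩
  have hρ : D.ρ (Finsupp.single c 1) = Finsupp.single (D.overArc c) (1 - tΛ) +
      Finsupp.single (D.b₁ c) tΛ - Finsupp.single (D.b₂ c) 1 := by
    rw [ρ, Finsupp.linearCombination_single, one_smul]
  rw [hρ, map_sub, map_add, sub_eq_zero] at h
  have hs (a : D.Arc) (f : ℤ[T;T⁻¹]) :
      (LinearMap.range D.ρ).mkQ (Finsupp.single a f) = f • D.ς a := by
    rw [ς, ← Submodule.mkQ_apply, ← map_smul, Finsupp.smul_single, smul_eq_mul, mul_one]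
  rw [hs, hs, hs, one_smul] at h
  exact h.symm

/-- The submodule `(1 - t) ker φ_L^red`. -/
def oneSubTKer : Submodule ℤ[T;T⁻¹] D.MAred :=
  (LinearMap.ker D.φred).map (LinearMap.lsmul ℤ[T;T⁻¹] D.MAred (1 - tΛ))

theorem mem_oneSubTKer {x : D.MAred} :
    x ∈ D.oneSubTKer ↔ ∃ n ∈ LinearMap.ker D.φred, x = (1 - tΛ) • n := by
  simp only [oneSubTKer, Submodule.mem_map, LinearMap.lsmul_apply, eq_comm]

theorem ς_sub_ς_mem_ker (a b : D.Arc) : D.ς a - D.ς b ∈ LinearMap.ker D.φred := by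
  rw [LinearMap.mem_ker, map_sub, φred_ς, φred_ς, sub_self]

/-- The crossing relation reads `b₂ - b₁ = (1 - t)(a - b₁)`. -/
theorem ς_under_sub_mem (c : D.Crossing) :
    D.ς (D.underIn c) - D.ς (D.underOut c) ∈ D.oneSubTKer := by
  have h : D.ς (D.b₂ c) - D.ς (D.b₁ c) ∈ D.oneSubTKer := by
    refine D.mem_oneSubTKer.2 ⟨_, D.ς_sub_ς_mem_ker (D.overArc c) (D.b₁ c), ?_⟩
    rw [ς_relation]
    module
  unfold b₁ b₂ at h
  split_ifs at h
  · rw [← neg_sub]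
    exact neg_mem h
  · exact h

/-- The arc which starts at a passage, or passes through it if it is an overpass. -/
def outArc (p : D.Passage) : D.Arc := D.arc (.inl p)

theorem outArc_next_symm_over (c : D.Crossing) :
    D.outArc (D.next.symm (c, true)) = D.overArc c := Quot.sound (.joins c)

/-- A property of arcs which passes from an arc to the following one holds throughout a
component. -/
theorem arc_induction {P : D.Arc → Prop}
    (hP : ∀ c, P (D.underIn c) → P (D.underOut c)) {a b : D.Arc} (hab : D.κ a = D.κ b)
    (ha : P a) : P b := by
  have step (p : D.Passage) (hp : P (D.outArc p)) : P (D.outArc (D.next p)) := by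
    obtain ⟨q, rfl⟩ := D.next.symm.surjective p
    rw [Equiv.apply_symm_apply]
    obtain ⟨c, _ | _⟩ := q
    · exact hP c hp
    · rwa [outArc_next_symm_over] at hp
  obtain ⟨p | i, rfl⟩ := Quot.exists_rep a <;> obtain ⟨q | j, rfl⟩ := Quot.exists_rep b
  · obtain ⟨n, rfl⟩ := ((D.comp_eq_iff p q).1 hab).exists_nat_pow_eq
    clear hab
    induction n with
    | zero => exact ha
    | succ n ih =>
      rw [pow_succ']
      exact step _ ih
  · exact absurd hab (j.2 p)
  · exact absurd hab.symm (i.2 q)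
  · rwa [← Subtype.ext (show i.1 = j.1 from hab)]

theorem exists_κ_eq (i : Fin μ) : ∃ a, D.κ a = i := by
  by_cases h : ∃ p, D.comp p = i
  · obtain ⟨p, hp⟩ := h
    exact ⟨D.outArc p, hp⟩
  · push Not at h
    exact ⟨D.arc (.inr ⟨i, h⟩), rfl⟩

theorem ς_sub_ς_mem_oneSubTKer {a b : D.Arc} (hab : D.κ a = D.κ b) :
    D.ς a - D.ς b ∈ D.oneSubTKer := by
  refine D.arc_induction (P := fun b => D.ς a - D.ς b ∈ D.oneSubTKer) (fun c hc => ?_) hab ?_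
  · rw [← sub_add_sub_cancel _ (D.ς (D.underIn c))]
    exact add_mem hc (D.ς_under_sub_mem c)
  · simp

theorem exists_sum_smul_ς_sub_mem {e : Fin μ → D.Arc} (he : ∀ i, D.κ (e i) = i) (x : D.MAred) :
    ∃ f : Fin μ → ℤ[T;T⁻¹], x - ∑ i, f i • D.ς (e i) ∈ D.oneSubTKer := by
  obtain ⟨g, rfl⟩ := (LinearMap.range D.ρ).mkQ_surjective x
  induction g using Finsupp.induction_linear with
  | zero => exact ⟨0, by simp⟩
  | add g h hg hh =>
    obtain ⟨f, hf⟩ := hg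
    obtain ⟨k, hk⟩ := hh
    refine ⟨f + k, ?_⟩
    convert add_mem hf hk using 1
    simp only [map_add, Pi.add_apply, add_smul, Finset.sum_add_distrib]
    abel
  | single a b =>
    refine ⟨Pi.single (D.κ a) b, ?_⟩
    rw [Fintype.sum_eq_single (D.κ a) (fun i hi => by rw [Pi.single_eq_of_ne hi, zero_smul]),
      Pi.single_eq_same]
    have h : (LinearMap.range D.ρ).mkQ (Finsupp.single a b) = b • D.ς a := by
      rw [ς, ← Submodule.mkQ_apply, ← map_smul, Finsupp.smul_single, smul_eq_mul, mul_one]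
    rw [h, ← smul_sub]
    exact Submodule.smul_mem _ _ (D.ς_sub_ς_mem_oneSubTKer (he _).symm)

theorem _root_.TrivialModule.smul_apply {ι : Type*} (f : ℤ[T;T⁻¹]) (v : TrivialModule ι) (i : ι) :
    (f • v : TrivialModule ι) i = LaurentPolynomial.eval₂ (RingHom.id ℤ) (1 : ℤˣ) f * v i := rfl

theorem _root_.TrivialModule.sum_apply {ι J : Type*} (s : Finset J) (v : J → TrivialModule ι)
    (i : ι) : (∑ j ∈ s, v j : TrivialModule ι) i = ∑ j ∈ s, v j i :=
  Finset.sum_apply (M := fun _ => ℤ) i s v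

theorem oneSubTKer_le_ker_φτ : D.oneSubTKer ≤ LinearMap.ker D.φτ := by
  intro x hx
  obtain ⟨n, hn, rfl⟩ := D.mem_oneSubTKer.1 hx
  have hn : (D.φτ n).1 = 0 := hn
  rw [LinearMap.mem_ker, map_smul]
  ext1
  · rw [Prod.smul_fst, hn, smul_zero]
    rfl
  · rw [Prod.smul_snd, sub_smul, TrivialModule.t_smul, one_smul, sub_self]
    rfl

/-- Modulo `(1 - t) ker φred` one arc per component generates. If `φτ` vanishes on `∑ fᵢ ς(eᵢ)`, the
`fᵢ` sum to zero, so each arc may be replaced by its difference from the first. Moreover `fᵢ(1) = 0`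
off the first component, so these `fᵢ` are divisible by `t - 1`. -/
theorem ker_φτ_le_oneSubTKer : LinearMap.ker D.φτ ≤ D.oneSubTKer := by
  intro x hx
  choose e he using D.exists_κ_eq
  obtain ⟨f, hf⟩ := D.exists_sum_smul_ς_sub_mem he x
  have h₀ : ∑ i, f i • D.arcValue (e i) = 0 := by
    have h := D.oneSubTKer_le_ker_φτ hf
    rw [LinearMap.mem_ker, map_sub, LinearMap.mem_ker.1 hx, zero_sub, neg_eq_zero, map_sum] at h
    simpa only [map_smul, φτ_ς] using h
  have h₁ : ∑ i, f i = 0 := by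
    have h := congrArg Prod.fst h₀
    simpa [Prod.fst_sum, arcValue] using h
  have h₂ (j : Fin μ) (hj : (j : ℕ) ≠ 0) :
      LaurentPolynomial.eval₂ (RingHom.id ℤ) (1 : ℤˣ) (f j) = 0 := by
    have h := congrFun (congrArg Prod.snd h₀) ⟨j, hj⟩
    rw [Prod.snd_sum, TrivialModule.sum_apply] at h
    replace h : ∑ i, LaurentPolynomial.eval₂ (RingHom.id ℤ) (1 : ℤˣ) (f i) *
        (if D.κ (e i) = j then 1 else 0) = 0 := h
    simpa [he] using h
  rw [← sub_add_cancel x (∑ i, f i • D.ς (e i))]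
  refine add_mem hf ?_
  rcases Nat.eq_zero_or_pos μ with rfl | hμ
  · simp
  · have h₃ : ∑ i, f i • D.ς (e i) = ∑ i, f i • (D.ς (e i) - D.ς (e ⟨0, hμ⟩)) := by
      simp only [smul_sub, Finset.sum_sub_distrib, ← Finset.sum_smul, h₁, zero_smul, sub_zero]
    rw [h₃]
    refine sum_mem fun i _ => ?_
    by_cases hi : (i : ℕ) = 0
    · rw [show i = ⟨0, hμ⟩ from Fin.ext hi, sub_self, smul_zero]
      exact zero_mem _
    · obtain ⟨h, hh⟩ := LaurentPolynomial.exists_sub_C_eval₂_eq_mul 1 (f i)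
      rw [h₂ i hi, map_zero, sub_zero] at hh
      refine D.mem_oneSubTKer.2 ⟨-h • (D.ς (e i) - D.ς (e ⟨0, hμ⟩)),
        Submodule.smul_mem _ _ (D.ς_sub_ς_mem_ker _ _), ?_⟩
      rw [hh, Units.val_one, map_one]
      module

end LinkDiagram

/-! ### Generators of IMQ -/

/-- Induction for elements of free abelian groups. -/
theorem Finsupp.int_induction {A : Type*} {P : (A →₀ ℤ) → Prop}
    (single : ∀ a, P (Finsupp.single a 1)) (add : ∀ v w, P v → P w → P (v + w))
    (neg : ∀ v, P v → P (-v)) (zero : P 0) (v : A →₀ ℤ) : P v := by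
  induction v using Finsupp.induction_linear with
  | zero => exact zero
  | add v w hv hw => exact add v w hv hw
  | single a n =>
    induction n using Int.induction_on with
    | zero => simpa using zero
    | succ n ih =>
      rw [Finsupp.single_add]
      exact add _ _ ih (single a)
    | pred n ih =>
      rw [Finsupp.single_sub, sub_eq_add_neg]
      exact add _ _ ih (neg _ (single a))

theorem AlexanderQuandle.medial {M : Type*} [AddCommGroup M] [Module ℤ[T;T⁻¹] M]
    (w x y z : AlexanderQuandle M) : (z ◃ y) ◃ (x ◃ w) = (z ◃ x) ◃ (y ◃ w) := by
  revert w x y z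
  intro (w : M) (x : M) (y : M) (z : M)
  change tΛ • (tΛ • w + (1 - tΛ) • x) + (1 - tΛ) • (tΛ • y + (1 - tΛ) • z) =
    tΛ • (tΛ • w + (1 - tΛ) • y) + (1 - tΛ) • (tΛ • x + (1 - tΛ) • z)
  module

namespace LinkDiagram

variable {μ : ℕ} (D : LinkDiagram μ)

/-- The generator of `IMQ(L)` given by an arc. -/
def imqGen (a : D.Arc) : D.IMQ :=
  InvolutoryQuotient.proj D.MQ (PresentedQuandle.mk _ (.gen a))

theorem imq_act_act (x y : D.IMQ) : x ◃ (x ◃ y) = y := InvolutoryQuotient.act_act x y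

theorem imq_medial (w x y z : D.IMQ) : (z ◃ y) ◃ (x ◃ w) = (z ◃ x) ◃ (y ◃ w) := by
  obtain ⟨w, rfl⟩ := InvolutoryQuotient.proj_surjective w
  obtain ⟨x, rfl⟩ := InvolutoryQuotient.proj_surjective x
  obtain ⟨y, rfl⟩ := InvolutoryQuotient.proj_surjective y
  obtain ⟨z, rfl⟩ := InvolutoryQuotient.proj_surjective z
  simp only [← ShelfHom.map_act]
  rw [PresentedQuandle.medial]

theorem imq_induction {P : D.IMQ → Prop} (gen : ∀ a, P (D.imqGen a))
    (act : ∀ x y, P x → P y → P (x ◃ y)) (x : D.IMQ) : P x := by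
  obtain ⟨x, rfl⟩ := InvolutoryQuotient.proj_surjective x
  induction x using PresentedQuandle.induction with
  | hgen a => exact gen a
  | hact x y hx hy =>
    rw [ShelfHom.map_act]
    exact act _ _ hx hy
  | hinv x y hx hy =>
    rw [ShelfHom.map_invAct_quandle]
    have h (x y : D.IMQ) : x ◃⁻¹ y = x ◃ y := by
      rw [← Rack.left_cancel x, Rack.right_inv, imq_act_act]
    rw [h]
    exact act _ _ hx hy

/-- Translations are involutions, so the writhe of the crossing no longer matters. -/
theorem imqGen_underOut (c : D.Crossing) :
    D.imqGen (D.underOut c) = D.imqGen (D.overArc c) ◃ D.imqGen (D.underIn c) := by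
  have h : D.imqGen (D.b₂ c) = D.imqGen (D.overArc c) ◃ D.imqGen (D.b₁ c) := by
    unfold imqGen
    rw [← ShelfHom.map_act]
    exact congrArg _ (PresentedQuandle.mk_eq_of_rel (.of (.crossing c)))
  unfold b₁ b₂ at h
  split_ifs at h
  · exact h
  · rw [h, imq_act_act]

/-! ### The homomorphism to the Alexander quandle -/

/-- The homomorphism `MQ(L) → M_A^red(L) / (1 + t)` which takes the generators to the generators. -/
def mqHom : D.MQ →◃ AlexanderQuandle D.MAredNegOne :=
  PresentedQuandle.lift (fun a => (D.ςNegOne a : D.MAredNegOne)) (by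
    rintro _ _ (⟨⟨c⟩⟩ | ⟨w, x, y, z⟩)
    · change D.ςNegOne (D.b₂ c) =
        tΛ • D.ςNegOne (D.b₁ c) + (1 - tΛ) • D.ςNegOne (D.overArc c)
      unfold ςNegOne
      rw [ς_relation, map_add, map_smul, map_smul, add_comm]
    · exact AlexanderQuandle.medial _ _ _ _)

theorem alexanderQuandle_act (x y : D.MAredNegOne) :
    ((show AlexanderQuandle D.MAredNegOne from x) ◃ (show AlexanderQuandle D.MAredNegOne from y) :
      AlexanderQuandle D.MAredNegOne) = (2 • x - y : D.MAredNegOne) := by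
  change tΛ • y + (1 - tΛ) • x = 2 • x - y
  rw [sub_smul, t_smul_MAredNegOne, t_smul_MAredNegOne]
  module

theorem alexanderQuandle_act_act (x y : AlexanderQuandle D.MAredNegOne) : x ◃ (x ◃ y) = y := by
  revert x y
  intro (x : D.MAredNegOne) (y : D.MAredNegOne)
  change tΛ • (tΛ • y + (1 - tΛ) • x) + (1 - tΛ) • x = y
  simp only [sub_smul, one_smul, t_smul_MAredNegOne]
  abel

/-- The homomorphism `IMQ(L) → M_A^red(L) / (1 + t)` which takes the generators to the
generators. -/
def imqHom : D.IMQ →◃ AlexanderQuandle D.MAredNegOne :=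
  PresentedQuandle.lift D.mqHom (by
    rintro _ _ (⟨x, y⟩ | ⟨x, y⟩)
    · exact D.mqHom.map_act.symm
    · simp only [QuandleWord.eval, ShelfHom.map_act]
      exact D.alexanderQuandle_act_act _ _)

/-- The underlying function of the homomorphism `IMQ(L) → M_A^red(L) / (1 + t)`. -/
def imqValue (x : D.IMQ) : D.MAredNegOne := D.imqHom x

theorem imqValue_gen (a : D.Arc) : D.imqValue (D.imqGen a) = D.ςNegOne a := rfl

theorem imqValue_act (x y : D.IMQ) :
    D.imqValue (x ◃ y) = 2 • D.imqValue x - D.imqValue y :=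
  (D.imqHom.map_act).trans (D.alexanderQuandle_act _ _)

/-! ### The displacement group -/

/-- `G` is the action of the free abelian group on the arcs on `IMQ(L)` in which an arc `a` acts
as the composition of the translations by the generators of `a` and `a₀`. -/
def IsDisplacement (a₀ : D.Arc) (G : Multiplicative (D.Arc →₀ ℤ) →* Equiv.Perm D.IMQ) : Prop :=
  ∀ a, G (Multiplicative.ofAdd (Finsupp.single a 1)) =
    Rack.act' (D.imqGen a) * Rack.act' (D.imqGen a₀)

theorem imq_act'_mul_self (x : D.IMQ) : Rack.act' x * Rack.act' x = 1 := by
  ext y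
  exact D.imq_act_act x y

theorem imq_act'_inv (x : D.IMQ) : (Rack.act' x)⁻¹ = Rack.act' x :=
  Rack.act'_inv_of_involutory D.imq_act_act x

/-- The identity `s_a s_{a₀} s_b = s_b s_{a₀} s_a` says exactly that the elements `s_a s_{a₀}`
commute. -/
theorem exists_isDisplacement (a₀ : D.Arc) : ∃ G, D.IsDisplacement a₀ G := by
  refine exists_finsupp_hom_of_commute _ fun a b => ?_
  have h := Rack.act'_swap_of_medial D.imq_act_act D.imq_medial (D.imqGen a) (D.imqGen a₀)
    (D.imqGen b)
  simp only [← mul_assoc, h]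

variable {D}

/-- The endomorphism `a ↦ a - a₀` of the free abelian group on the arcs. -/
def subBase (a₀ : D.Arc) : (D.Arc →₀ ℤ) →+ (D.Arc →₀ ℤ) :=
  Finsupp.liftAddHom fun a =>
    zmultiplesHom _ (Finsupp.single a 1 - Finsupp.single a₀ 1)

theorem subBase_single (a₀ a : D.Arc) (n : ℤ) :
    subBase a₀ (Finsupp.single a n) = n • (Finsupp.single a 1 - Finsupp.single a₀ 1) := by
  simp [subBase]

/-- Replacing each `a` by `a - a₀` loses the total degree times `a₀`; on `ker φred` nothing is lost.
-/
theorem arcSum_eq_arcSum_subBase (a₀ : D.Arc) (f : D.Arc →₀ ℤ[T;T⁻¹]) :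
    D.arcSum (finsuppEvalNegOne _ f) = D.arcSum (subBase a₀ (finsuppEvalNegOne _ f)) +
      evalNegOne (D.φred ((LinearMap.range D.ρ).mkQ f)) • D.ςNegOne a₀ := by
  induction f using Finsupp.induction_linear with
  | zero => simp
  | add f g hf hg =>
    simp only [map_add, hf, hg, add_smul]
    abel
  | single a f =>
    have h : (LinearMap.range D.ρ).mkQ (Finsupp.single a f) = f • D.ς a := by
      rw [ς, ← Submodule.mkQ_apply, ← map_smul, Finsupp.smul_single, smul_eq_mul, mul_one]
    rw [h, map_smul, φred_ς, smul_eq_mul, mul_one, finsuppEvalNegOne_single, subBase_single,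
      map_zsmul, map_sub]
    simp only [arcSum_single, one_smul]
    module

open Multiplicative (ofAdd)

namespace IsDisplacement

variable {a₀ : D.Arc} {G : Multiplicative (D.Arc →₀ ℤ) →* Equiv.Perm D.IMQ}

theorem apply_base (hG : D.IsDisplacement a₀ G) : G (ofAdd (Finsupp.single a₀ 1)) = 1 := by
  rw [hG, imq_act'_mul_self]

theorem apply_subBase (hG : D.IsDisplacement a₀ G) (v : D.Arc →₀ ℤ) :
    G (ofAdd (subBase a₀ v)) = G (ofAdd v) := by
  induction v using Finsupp.int_induction with
  | single a =>
    rw [subBase_single, one_smul, ofAdd_sub, map_div, hG.apply_base, div_one]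
  | add v w hv hw => rw [map_add, ofAdd_add, ofAdd_add, map_mul, map_mul, hv, hw]
  | neg v hv => rw [map_neg, ofAdd_neg, ofAdd_neg, map_inv, map_inv, hv]
  | zero => simp

/-- The composite of two point reflections is the translation by twice the difference of their
centres. -/
theorem imqValue_apply (hG : D.IsDisplacement a₀ G) (v : D.Arc →₀ ℤ) (x : D.IMQ) :
    D.imqValue (G (ofAdd v) x) = D.imqValue x + 2 • D.arcSum (subBase a₀ v) := by
  induction v using Finsupp.int_induction generalizing x with
  | single a =>
    rw [hG]
    change D.imqValue (D.imqGen a ◃ (D.imqGen a₀ ◃ x)) = _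
    rw [imqValue_act, imqValue_act, imqValue_gen, imqValue_gen, subBase_single, one_smul, map_sub,
      arcSum_single, arcSum_single]
    module
  | add v w hv hw =>
    rw [ofAdd_add, map_mul, Equiv.Perm.mul_apply, hv, hw, map_add, map_add]
    module
  | neg v hv =>
    have h := hv (G (ofAdd (-v)) x)
    rw [← Equiv.Perm.mul_apply, ← map_mul, ← ofAdd_add, add_neg_cancel, ofAdd_zero, map_one,
      Equiv.Perm.one_apply] at h
    rw [h, map_neg (subBase a₀), map_neg D.arcSum]
    module
  | zero => simp

/-- Dihedral relation: `s_{a₀} (s_a s_{a₀}) s_{a₀} = s_{a₀} s_a`, the inverse of `s_a s_{a₀}`. -/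
theorem conj_apply (hG : D.IsDisplacement a₀ G) (v : D.Arc →₀ ℤ) :
    Rack.act' (D.imqGen a₀) * G (ofAdd v) * Rack.act' (D.imqGen a₀) = G (ofAdd (-v)) := by
  have h₀ := D.imq_act'_mul_self (D.imqGen a₀)
  have h₁ := D.imq_act'_inv (D.imqGen a₀)
  induction v using Finsupp.int_induction with
  | single a =>
    rw [ofAdd_neg, map_inv, hG, mul_inv_rev, imq_act'_inv, imq_act'_inv, mul_assoc, mul_assoc, h₀, mul_one]
  | add v w hv hw =>
    rw [neg_add, ofAdd_add, ofAdd_add, map_mul, map_mul, ← hv, ← hw]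
    simp only [mul_assoc]
    rw [← mul_assoc (Rack.act' (D.imqGen a₀)) (Rack.act' (D.imqGen a₀)), h₀, one_mul]
  | neg v hv =>
    have h := congrArg (·⁻¹) hv
    simp only [mul_inv_rev, h₁, ← map_inv, ← ofAdd_neg] at h
    rw [mul_assoc]
    exact h
  | zero => simp [h₀]

theorem exists_act'_eq (hG : D.IsDisplacement a₀ G) (x : D.IMQ) :
    ∃ v, Rack.act' x = G (ofAdd v) * Rack.act' (D.imqGen a₀) := by
  induction x using D.imq_induction with
  | gen a =>
    refine ⟨Finsupp.single a 1, ?_⟩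
    rw [hG, mul_assoc, imq_act'_mul_self, mul_one]
  | act x y hx hy =>
    obtain ⟨v, hv⟩ := hx
    obtain ⟨w, hw⟩ := hy
    -- The translation by `x ◃ y` is `s_x s_y s_x`, and moving the middle `s_{a₀}` past `G w`
    -- inverts it.
    refine ⟨v + -w + v, ?_⟩
    rw [Rack.ad_conj, imq_act'_inv, hv, hw, ofAdd_add, ofAdd_add, map_mul, map_mul,
      ← hG.conj_apply]
    simp only [mul_assoc]

/-- The action of the free abelian group on the arcs reaches every element from a generator. -/
theorem exists_eq_apply (hG : D.IsDisplacement a₀ G) (x : D.IMQ) :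
    ∃ v a, x = G (ofAdd v) (D.imqGen a) := by
  induction x using D.imq_induction with
  | gen a => exact ⟨0, a, by simp⟩
  | act x y hx hy =>
    obtain ⟨v, hv⟩ := hG.exists_act'_eq x
    obtain ⟨w, a, rfl⟩ := hy
    -- Since `s_a` fixes `q_a`, applying `s_{a₀}` to `q_a` is the same as applying `s_{a₀} s_a`, the
    -- displacement of `-a`.
    have h₁ : Rack.act' (D.imqGen a₀) (D.imqGen a) =
        G (ofAdd (-Finsupp.single a 1)) (D.imqGen a) := by
      rw [ofAdd_neg, map_inv, hG, mul_inv_rev, imq_act'_inv, imq_act'_inv, Equiv.Perm.mul_apply]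
      exact congrArg _ (Quandle.fix (x := D.imqGen a)).symm
    refine ⟨v + -w + -Finsupp.single a 1, a, ?_⟩
    change Rack.act' x (G (ofAdd w) (D.imqGen a)) = _
    rw [hv, ofAdd_add, map_mul, Equiv.Perm.mul_apply, Equiv.Perm.mul_apply, ← h₁,
      ← Equiv.Perm.mul_apply (G _), ofAdd_add, map_mul, ← hG.conj_apply w]
    simp only [Equiv.Perm.mul_apply]
    congr 3
    exact (D.imq_act_act (D.imqGen a₀) (D.imqGen a)).symm

theorem act'_underOut (c : D.Crossing) :
    Rack.act' (D.imqGen (D.underOut c)) = Rack.act' (D.imqGen (D.overArc c)) *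
      Rack.act' (D.imqGen (D.underIn c)) * Rack.act' (D.imqGen (D.overArc c)) := by
  rw [imqGen_underOut, Rack.ad_conj, imq_act'_inv]

/-- The translation by the outgoing arc is `s_over s_in s_over`, so the displacement of `over - in +
over` equals that of the outgoing arc. -/
theorem apply_relNegOne (hG : D.IsDisplacement a₀ G) (c : D.Crossing) :
    G (ofAdd (D.relNegOne c)) = 1 := by
  have h₀ := D.imq_act'_mul_self (D.imqGen a₀)
  rw [relNegOne, ofAdd_sub, map_div, div_eq_one, hG, act'_underOut, two_smul, sub_eq_add_neg,
    add_right_comm, ofAdd_add, ofAdd_add, map_mul, map_mul, ofAdd_neg, map_inv, hG, hG,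
    mul_inv_rev, imq_act'_inv, imq_act'_inv]
  simp only [mul_assoc]
  rw [← mul_assoc (Rack.act' (D.imqGen a₀)) (Rack.act' (D.imqGen a₀)), h₀, one_mul]

theorem apply_sum_relNegOne (hG : D.IsDisplacement a₀ G) (s : D.Crossing → ℤ) :
    G (ofAdd (∑ c, s c • D.relNegOne c)) = 1 := by
  rw [ofAdd_sum, ← MonoidHom.mem_ker]
  refine prod_mem fun c _ => ?_
  rw [ofAdd_zsmul]
  exact zpow_mem (hG.apply_relNegOne c) _

/-- This displacement is `s_over s_in`, and `s_in` fixes its own generator. -/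
theorem apply_overArc_sub_underIn (hG : D.IsDisplacement a₀ G) (c : D.Crossing) :
    G (ofAdd (Finsupp.single (D.overArc c) 1 - Finsupp.single (D.underIn c) 1))
      (D.imqGen (D.underIn c)) = D.imqGen (D.underOut c) := by
  rw [ofAdd_sub, map_div, hG, hG, div_eq_mul_inv, mul_inv_rev, imq_act'_inv, imq_act'_inv,
    mul_assoc, ← mul_assoc (Rack.act' (D.imqGen a₀)), imq_act'_mul_self, one_mul,
    imqGen_underOut]
  exact congrArg (D.imqGen (D.overArc c) ◃ ·) (Quandle.fix (x := D.imqGen (D.underIn c)))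

theorem exists_apply_imqGen (hG : D.IsDisplacement a₀ G) {a b : D.Arc} (hab : D.κ a = D.κ b) :
    ∃ v, D.imqGen b = G (ofAdd v) (D.imqGen a) := by
  refine D.arc_induction (P := fun b => ∃ v, D.imqGen b = G (ofAdd v) (D.imqGen a))
    (fun c hc => ?_) hab ⟨0, by simp⟩
  obtain ⟨v, hv⟩ := hc
  refine ⟨(Finsupp.single (D.overArc c) 1 - Finsupp.single (D.underIn c) 1) + v, ?_⟩
  rw [ofAdd_add, map_mul, Equiv.Perm.mul_apply, ← hv]
  exact (hG.apply_overArc_sub_underIn c).symm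

end IsDisplacement

/-! ### Walking once around a component -/

variable (D) in
/-- The displacement from the arc which enters a passage to the arc which leaves it. -/
def passageShift : D.Passage → (D.Arc →₀ ℤ)
  | (_, true) => 0
  | (c, false) => Finsupp.single (D.overArc c) 1 - Finsupp.single (D.underIn c) 1

theorem IsDisplacement.apply_passageShift {a₀ : D.Arc}
    {G : Multiplicative (D.Arc →₀ ℤ) →* Equiv.Perm D.IMQ} (hG : D.IsDisplacement a₀ G)
    (p : D.Passage) :
    G (ofAdd (D.passageShift (D.next p))) (D.imqGen (D.outArc p)) =
      D.imqGen (D.outArc (D.next p)) := by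
  obtain ⟨q, rfl⟩ := D.next.symm.surjective p
  rw [Equiv.apply_symm_apply]
  obtain ⟨c, _ | _⟩ := q
  · exact hG.apply_overArc_sub_underIn c
  · rw [outArc_next_symm_over]
    simp only [passageShift, ofAdd_zero, map_one, Equiv.Perm.one_apply]
    rfl

/-- One period of `next` visits each passage of the component exactly once. The index is `j + 1`
because a shift is incurred on reaching the following passage. -/
theorem sum_range_minimalPeriod {Y : Type*} [AddCommMonoid Y] (w : D.Passage → Y)
    (p : D.Passage) :
    ∑ j ∈ Finset.range (Function.minimalPeriod D.next p), w (D.next^[j + 1] p) =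
      ∑ q, if D.comp q = D.comp p then w q else 0 := by
  rw [← Finset.sum_filter]
  refine Finset.sum_nbij (fun j => D.next^[j + 1] p) (fun j _ => ?_) ?_ ?_ (fun _ _ => rfl)
  · rw [Finset.mem_filter]
    refine ⟨Finset.mem_univ _, ((D.comp_eq_iff _ _).2 ⟨(j + 1 : ℕ), ?_⟩).symm⟩
    rw [zpow_natCast, Equiv.Perm.coe_pow]
  · intro j hj k hk hjk
    simp only [Function.iterate_succ_apply'] at hjk
    rw [Finset.coe_range] at hj hk
    exact Function.iterate_injOn_Iio_minimalPeriod hj hk (D.next.injective hjk)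
  · intro q hq
    have hq : D.comp q = D.comp p := (Finset.mem_filter.1 hq).2
    obtain ⟨n, hn⟩ := ((D.comp_eq_iff p (D.next.symm q)).1 (by
      rw [← hq]
      exact ((D.comp_eq_iff _ _).2 ⟨1, by simp⟩).symm)).exists_nat_pow_eq
    refine ⟨n % Function.minimalPeriod D.next p, ?_, ?_⟩
    · rw [Finset.coe_range]
      exact Nat.mod_lt _ (Function.minimalPeriod_pos_of_mem_periodicPts
        (D.next.injective.mem_periodicPts p))
    · change D.next^[_ + 1] p = q
      rw [Function.iterate_succ_apply', Function.iterate_mod_minimalPeriod_eq,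
        ← Equiv.Perm.coe_pow, hn, Equiv.apply_symm_apply]

variable (D) in
/-- The displacement along a whole component. -/
def componentShift (i : Fin μ) : D.Arc →₀ ℤ :=
  ∑ c, if D.comp (c, false) = i then
    Finsupp.single (D.overArc c) 1 - Finsupp.single (D.underIn c) 1 else 0

/-- The shifts accumulated along the component carry `q_a` from arc to arc and finally back to
itself; a component without underpasses has zero shift. -/
theorem IsDisplacement.apply_componentShift {a₀ : D.Arc}
    {G : Multiplicative (D.Arc →₀ ℤ) →* Equiv.Perm D.IMQ} (hG : D.IsDisplacement a₀ G)
    (a : D.Arc) : G (ofAdd (D.componentShift (D.κ a))) (D.imqGen a) = D.imqGen a := by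
  obtain ⟨p | i, rfl⟩ := Quot.exists_rep a
  · have h₁ (k : ℕ) : G (ofAdd (∑ j ∈ Finset.range k, D.passageShift (D.next^[j + 1] p)))
        (D.imqGen (D.outArc p)) = D.imqGen (D.outArc (D.next^[k] p)) := by
      induction k with
      | zero => simp
      | succ k ih =>
        rw [Finset.sum_range_succ, add_comm, ofAdd_add, map_mul, Equiv.Perm.mul_apply, ih,
          Function.iterate_succ_apply', hG.apply_passageShift]
    have h₂ := h₁ (Function.minimalPeriod D.next p)
    rw [Function.iterate_minimalPeriod, sum_range_minimalPeriod, Fintype.sum_prod_type] at h₂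
    simp only [Fintype.sum_bool, passageShift, ite_self, zero_add] at h₂
    exact h₂
  · have h : D.componentShift (D.κ (Quot.mk _ (.inr i))) = 0 :=
      Finset.sum_eq_zero fun c _ => if_neg (i.2 _)
    rw [h, ofAdd_zero, map_one, Equiv.Perm.one_apply]

theorem comp_next (p : D.Passage) : D.comp (D.next p) = D.comp p :=
  ((D.comp_eq_iff _ _).2 ⟨1, by simp⟩).symm

theorem comp_next_symm (p : D.Passage) : D.comp (D.next.symm p) = D.comp p := by
  rw [← comp_next, Equiv.apply_symm_apply]

theorem κ_underIn (c : D.Crossing) : D.κ (D.underIn c) = D.comp (c, false) := comp_next_symm _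

theorem κ_underOut (c : D.Crossing) : D.κ (D.underOut c) = D.comp (c, false) := rfl

/-! ### Parity of the coefficients of relators -/

variable (D) in
/-- The mod 2 boundary of a function on the passages, as a function on the segments. -/
def passageBoundary : (D.Passage → ZMod 2) →ₗ[ZMod 2] (D.Passage → ZMod 2) :=
  LinearMap.id + LinearMap.funLeft _ _ D.next

theorem passageBoundary_apply (R : D.Passage → ZMod 2) (p : D.Passage) :
    D.passageBoundary R p = R p + R (D.next p) := rfl

open Classical in
theorem passageBoundary_single (p : D.Passage) :
    D.passageBoundary (Pi.single p 1) = Pi.single p 1 + Pi.single (D.next.symm p) 1 := by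
  ext q
  rw [passageBoundary_apply, Pi.add_apply]
  congr 1
  simp only [Pi.single_apply, Equiv.eq_symm_apply]

variable (D) in
/-- The mod 2 boundaries of the functions which vanish on the underpasses. -/
def overBoundaries : Submodule (ZMod 2) (D.Passage → ZMod 2) :=
  Submodule.map D.passageBoundary {
    carrier := {R | ∀ c, R (c, false) = 0}
    add_mem' := fun hR hS c => by rw [Pi.add_apply, hR c, hS c, add_zero]
    zero_mem' := fun _ => rfl
    smul_mem' := fun a R hR c => by rw [Pi.smul_apply, hR c, smul_zero] }

open Classical in
variable (D) in
/-- The class of an arc modulo 2 in the quotient of the space of functions on the segments. -/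
def arcClass : D.Arc → (D.Passage → ZMod 2) ⧸ D.overBoundaries :=
  Quot.lift (fun s => D.overBoundaries.mkQ (s.elim (fun p => Pi.single p 1) fun _ => 0)) (by
    rintro _ _ ⟨c⟩
    refine (Submodule.Quotient.eq _).2 ⟨Pi.single (c, true) 1, fun d => ?_, ?_⟩
    · exact Pi.single_eq_of_ne (by simp) _
    · rw [passageBoundary_single, add_comm]
      simp only [Sum.elim_inl, sub_eq_add_neg]
      congr 1
      ext p
      rw [Pi.neg_apply, CharTwo.neg_eq])

variable (D) in
/-- The class modulo 2 of an element of the free abelian group on the arcs. -/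
def arcSumClass : (D.Arc →₀ ℤ) →+ (D.Passage → ZMod 2) ⧸ D.overBoundaries :=
  Finsupp.liftAddHom fun a => zmultiplesHom _ (D.arcClass a)

theorem arcSumClass_single (a : D.Arc) : D.arcSumClass (Finsupp.single a 1) = D.arcClass a := by
  simp [arcSumClass]

theorem zmodTwo_two_smul {V : Type*} [AddCommGroup V] [Module (ZMod 2) V] (x : V) :
    2 • x = 0 := by
  rw [← Nat.cast_smul_eq_nsmul (ZMod 2), show ((2 : ℕ) : ZMod 2) = 0 from rfl, zero_smul]

open Classical in
-- Modulo 2 the overpassing arc drops out, leaving the two segments adjacent to the underpass.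
theorem arcSumClass_relNegOne (c : D.Crossing) : D.arcSumClass (D.relNegOne c) =
    -D.overBoundaries.mkQ (D.passageBoundary (Pi.single (c, false) 1)) := by
  rw [relNegOne, map_sub, map_sub, map_nsmul, zmodTwo_two_smul, arcSumClass_single,
    arcSumClass_single, passageBoundary_single, map_add, zero_sub, neg_add, sub_eq_add_neg,
    add_comm]
  rfl

/-- If a combination of relators at `t = -1` is divisible by 2, then the parity of its coefficients
is constant on the underpasses of each component. -/
theorem cast_eq_cast_of_two_smul_eq {v : D.Arc →₀ ℤ} {r : D.Crossing → ℤ}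
    (h : 2 • v = ∑ c, r c • D.relNegOne c) {c d : D.Crossing}
    (hcd : D.comp (c, false) = D.comp (d, false)) : (r c : ZMod 2) = r d := by
  classical
  let R₀ : D.Passage → ZMod 2 := fun p => if p.2 then 0 else r p.1
  have hR₀ : R₀ = ∑ c, r c • Pi.single (c, false) 1 := by
    ext ⟨d, b⟩
    rw [Finset.sum_apply]
    simp only [Pi.smul_apply, Pi.single_apply, Prod.mk.injEq]
    cases b <;> simp [R₀]
  have hmem : D.passageBoundary R₀ ∈ D.overBoundaries := by
    have h₁ := congrArg D.arcSumClass h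
    simp only [map_nsmul, zmodTwo_two_smul, map_sum, map_zsmul, arcSumClass_relNegOne, smul_neg,
      Finset.sum_neg_distrib] at h₁
    rw [eq_comm, neg_eq_zero] at h₁
    rw [← Submodule.Quotient.mk_eq_zero, ← Submodule.mkQ_apply, hR₀]
    simpa only [map_sum, map_zsmul] using h₁
  obtain ⟨S, hS, hSR⟩ := hmem
  -- A mod 2 function with zero boundary is invariant under `next`; at underpasses `R₀ - S` is still
  -- the parity of `r`.
  have hstep (p : D.Passage) : (R₀ - S) (D.next p) = (R₀ - S) p := by
    have h₂ := congrFun hSR p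
    rw [passageBoundary_apply, passageBoundary_apply] at h₂
    rw [Pi.sub_apply, Pi.sub_apply]
    grind
  have hval (c : D.Crossing) : (R₀ - S) (c, false) = r c := by
    rw [Pi.sub_apply, hS c]
    simp [R₀]
  obtain ⟨n, hn⟩ := ((D.comp_eq_iff _ _).1 hcd).exists_nat_pow_eq
  rw [← hval c, ← hval d, ← hn]
  clear hn
  induction n with
  | zero => rfl
  | succ n ih => rw [pow_succ', Equiv.Perm.mul_apply, hstep, ih]

/-! ### Combinations of the relators -/

variable (D) in
/-- The number of arcs of a component in an element of the free abelian group on the arcs. -/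
def componentDegree (i : Fin μ) : (D.Arc →₀ ℤ) →+ ℤ :=
  Finsupp.liftAddHom fun a => zmultiplesHom ℤ (if D.κ a = i then 1 else 0)

theorem componentDegree_single (i : Fin μ) (a : D.Arc) :
    D.componentDegree i (Finsupp.single a 1) = if D.κ a = i then 1 else 0 := by
  simp [componentDegree]

theorem even_componentDegree_relNegOne (i : Fin μ) (c : D.Crossing) :
    Even (D.componentDegree i (D.relNegOne c)) := by
  rw [relNegOne, map_sub, map_sub, map_nsmul, componentDegree_single, componentDegree_single,
    componentDegree_single, κ_underIn, κ_underOut]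
  grind

/-- Relators have even degree on each component, whereas `a - b` would have odd degree on the
component of `a`. -/
theorem κ_eq_of_single_sub_add {a b : D.Arc} {v : D.Arc →₀ ℤ} {r : D.Crossing → ℤ}
    (h : Finsupp.single a 1 - Finsupp.single b 1 + 2 • v = ∑ c, r c • D.relNegOne c) :
    D.κ a = D.κ b := by
  by_contra hne
  have h₁ := congrArg (D.componentDegree (D.κ a)) h
  rw [map_add, map_sub, map_nsmul, componentDegree_single, componentDegree_single, if_pos rfl,
    if_neg (Ne.symm hne), map_sum] at h₁
  have h₂ : Even (∑ c, D.componentDegree (D.κ a) (r c • D.relNegOne c)) := by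
    refine Finset.even_sum _ fun c _ => ?_
    rw [map_zsmul, smul_eq_mul]
    exact (even_componentDegree_relNegOne _ c).mul_left _
  rw [← h₁] at h₂
  grind

/-- A relator is `2 (over - in) + (in - out)`, and the terms `in - out` telescope around the
component. -/
theorem sum_componentRelators (i : Fin μ) :
    (∑ c, if D.comp (c, false) = i then D.relNegOne c else 0) = 2 • D.componentShift i := by
  have h₁ : (∑ p, if D.comp p = i then Finsupp.single (D.outArc (D.next.symm p)) (1 : ℤ) else 0) =
      ∑ p, if D.comp p = i then Finsupp.single (D.outArc p) (1 : ℤ) else 0 := by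
    rw [← Equiv.sum_comp D.next.symm fun p => if D.comp p = i then
      Finsupp.single (D.outArc p) (1 : ℤ) else 0]
    simp only [comp_next_symm]
  rw [Fintype.sum_prod_type, Fintype.sum_prod_type] at h₁
  simp only [Fintype.sum_bool, Finset.sum_add_distrib, outArc_next_symm_over] at h₁
  have h₂ : (∑ c, if D.comp (c, false) = i then Finsupp.single (D.underIn c) (1 : ℤ) else 0) =
      ∑ c, if D.comp (c, false) = i then Finsupp.single (D.underOut c) (1 : ℤ) else 0 :=
    add_left_cancel h₁
  rw [← sub_eq_zero, ← Finset.sum_sub_distrib] at h₂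
  rw [← sub_eq_zero, componentShift, Finset.smul_sum, ← Finset.sum_sub_distrib]
  refine (Finset.sum_congr rfl fun c _ => ?_).trans h₂
  split_ifs
  · rw [relNegOne]
    module
  · simp

/-- The signed sum of the relators of a classical diagram at `t = -1` vanishes. -/
theorem IsClassical.exists_signs (hD : D.IsClassical) :
    ∃ ε : D.Crossing → ℤ, (∀ c, Odd (ε c)) ∧ ∑ c, ε c • D.relNegOne c = 0 := by
  obtain ⟨ℓ, hℓ, hnext, hcross⟩ := hD.exists_alternating
  refine ⟨fun c => ℓ (c, true), fun c => ?_, ?_⟩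
  · change Odd (ℓ (c, true))
    obtain h | h := hℓ (c, true) <;> rw [h] <;> decide
  -- Each segment occurs at both its ends with opposite signs. Grouped by crossings, the same sum is
  -- the signed sum of relators, because the two passages of a crossing have opposite signs.
  have h₁ : ∑ p, ℓ p • (Finsupp.single (D.outArc (D.next.symm p)) (1 : ℤ) +
      Finsupp.single (D.outArc p) 1) = 0 := by
    simp only [smul_add, Finset.sum_add_distrib]
    rw [← Equiv.sum_comp D.next, ← Finset.sum_add_distrib]
    refine Finset.sum_eq_zero fun p _ => ?_
    rw [Equiv.symm_apply_apply, hnext]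
    module
  rw [Fintype.sum_prod_type] at h₁
  rw [← h₁]
  refine Finset.sum_congr rfl fun c _ => ?_
  rw [Fintype.sum_bool, hcross, outArc_next_symm_over]
  change ℓ (c, true) • D.relNegOne c = ℓ (c, true) • (Finsupp.single (D.overArc c) 1 +
    Finsupp.single (D.overArc c) 1) + -ℓ (c, true) • (Finsupp.single (D.underIn c) 1 +
    Finsupp.single (D.underOut c) 1)
  rw [relNegOne]
  module

/-- For a classical diagram of a link with at most two components, a combination of the relators
which is divisible by 2 is twice a multiple of the shift along a given component,
up to twice a combination of the relators. -/
theorem IsClassical.exists_eq_componentShift (hμ : μ ≤ 2) (hD : D.IsClassical) (i : Fin μ)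
    {v : D.Arc →₀ ℤ} {r : D.Crossing → ℤ} (h : 2 • v = ∑ c, r c • D.relNegOne c) :
    ∃ (e : ℤ) (s : D.Crossing → ℤ), v = e • D.componentShift i + ∑ c, s c • D.relNegOne c := by
  -- If some coefficient off component `i` is odd, adding the vanishing odd combination makes it
  -- even. As `μ ≤ 2`, all underpasses off `i` lie on one component and so have the same parity.
  wlog hr : ∀ c, D.comp (c, false) ≠ i → Even (r c) generalizing r
  · push Not at hr
    obtain ⟨c, hc, hrc⟩ := hr
    obtain ⟨ε, hε, hε₀⟩ := hD.exists_signs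
    refine this (r := fun c => r c + ε c) ?_ fun d hd => ?_
    · simp only [add_smul, Finset.sum_add_distrib, hε₀, add_zero, h]
    · have hcd : D.comp (c, false) = D.comp (d, false) := by
        ext
        have h₁ := (D.comp (c, false)).2
        have h₂ := (D.comp (d, false)).2
        have h₃ := Fin.val_ne_of_ne hc
        have h₄ := Fin.val_ne_of_ne hd
        lia
      have hrd := cast_eq_cast_of_two_smul_eq h hcd
      rw [ZMod.intCast_eq_intCast_iff_dvd_sub] at hrd
      have := hε d
      grind
  obtain ⟨e, he⟩ : ∃ e : ℤ, ∀ c, D.comp (c, false) = i → Even (r c - e) := by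
    by_cases hi : ∃ c, D.comp (c, false) = i
    · obtain ⟨c, hc⟩ := hi
      refine ⟨r c, fun d hd => ?_⟩
      have hrd := cast_eq_cast_of_two_smul_eq h (hc.trans hd.symm)
      rw [ZMod.intCast_eq_intCast_iff_dvd_sub] at hrd
      exact even_iff_two_dvd.2 hrd
    · exact ⟨0, fun c hc => absurd ⟨c, hc⟩ hi⟩
  have hs (c : D.Crossing) : ∃ s, r c = (if D.comp (c, false) = i then e else 0) + 2 * s := by
    split_ifs with hc
    · obtain ⟨s, hs⟩ := he c hc
      exact ⟨s, by lia⟩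
    · obtain ⟨s, hs⟩ := hr c hc
      exact ⟨s, by lia⟩
  choose s hs using hs
  -- The free abelian group on the arcs has no 2-torsion, so the identity may be checked after
  -- doubling.
  refine ⟨e, s, nsmul_right_injective two_ne_zero ?_⟩
  beta_reduce
  rw [h, smul_add, smul_comm, ← sum_componentRelators, Finset.smul_sum, Finset.smul_sum,
    ← Finset.sum_add_distrib]
  refine Finset.sum_congr rfl fun c _ => ?_
  rw [hs c]
  split_ifs <;> module

/-! ### The isomorphism -/

theorem imqValue_injective (hμ : μ ≤ 2) (hD : D.IsClassical) :
    Function.Injective D.imqValue := by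
  intro x y hxy
  obtain ⟨a₀⟩ : Nonempty D.Arc :=
    D.imq_induction (P := fun _ => Nonempty D.Arc) (fun a => ⟨a⟩) (fun _ _ h _ => h) x
  obtain ⟨G, hG⟩ := D.exists_isDisplacement a₀
  obtain ⟨v, a, rfl⟩ := hG.exists_eq_apply x
  obtain ⟨w, b, rfl⟩ := hG.exists_eq_apply y
  have hab : D.κ a = D.κ b := by
    rw [hG.imqValue_apply, hG.imqValue_apply, imqValue_gen, imqValue_gen] at hxy
    have h : D.arcSum (Finsupp.single a 1 - Finsupp.single b 1 + 2 • (subBase a₀ (v - w))) = 0 := by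
      simp only [map_add, map_sub, map_nsmul, arcSum_single, one_smul]
      rw [← sub_eq_zero] at hxy
      rw [← hxy]
      module
    obtain ⟨r, hr⟩ := D.exists_sum_relNegOne_of_arcSum_eq_zero h
    exact κ_eq_of_single_sub_add hr
  -- Both elements are now moved into the orbit of the same generator, so only a stabiliser question
  -- remains.
  obtain ⟨z, hz⟩ := hG.exists_apply_imqGen hab
  rw [hz, ← Equiv.Perm.mul_apply, ← map_mul, ← ofAdd_add] at hxy ⊢
  have h : D.arcSum (2 • subBase a₀ (v - (w + z))) = 0 := by
    rw [hG.imqValue_apply, hG.imqValue_apply, add_right_inj] at hxy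
    rw [map_nsmul, map_sub, map_sub, smul_sub, sub_eq_zero, hxy]
  obtain ⟨r, hr⟩ := D.exists_sum_relNegOne_of_arcSum_eq_zero h
  obtain ⟨e, s, hes⟩ := hD.exists_eq_componentShift hμ (D.κ a) hr
  have hfix : G (ofAdd (v - (w + z))) (D.imqGen a) = D.imqGen a := by
    rw [← hG.apply_subBase, hes, ofAdd_add, map_mul, hG.apply_sum_relNegOne, mul_one, ofAdd_zsmul,
      map_zpow]
    exact zpow_mem (show _ ∈ MulAction.stabilizer (Equiv.Perm D.IMQ) (D.imqGen a) from
      hG.apply_componentShift a) e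
  rw [← add_sub_cancel (w + z) v, ofAdd_add, map_mul, Equiv.Perm.mul_apply, hfix]

/-- An arc and the chosen meridian of its component have the same `φτ`, hence differ by an element
of `(1 - t) ker φred`. -/
theorem imqValue_mem (m : Fin μ → D.MAred) (hm : ∀ i, D.IsMeridian i (m i)) (x : D.IMQ) :
    D.imqHom x ∈ (D.QAredImage m hm).carrier := by
  induction x using D.imq_induction with
  | gen a =>
    obtain ⟨b, hb, hφ⟩ := hm (D.κ a)
    have h : D.ς a - m (D.κ a) ∈ D.oneSubTKer := by
      refine D.ker_φτ_le_oneSubTKer ?_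
      rw [LinearMap.mem_ker, map_sub, hφ, φτ_ς, φτ_ς, arcValue, arcValue, hb, sub_self]
    obtain ⟨n, hn, h⟩ := D.mem_oneSubTKer.1 h
    exact ⟨D.ς a, ⟨D.κ a, n, hn, by rw [← h, add_sub_cancel]⟩, rfl⟩
  | act x y hx hy =>
    rw [ShelfHom.map_act]
    exact (D.QAredImage m hm).act_mem hx hy

theorem exists_imqValue_eq (m : Fin μ → D.MAred) (hm : ∀ i, D.IsMeridian i (m i))
    (y : (D.QAredImage m hm).carrier) : ∃ x, D.imqHom x = y := by
  obtain ⟨_, _, ⟨i, n, hn, rfl⟩, rfl⟩ := y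
  obtain ⟨a, ha, hφ⟩ := hm i
  have h : m i - D.ς a ∈ D.oneSubTKer := by
    refine D.ker_φτ_le_oneSubTKer ?_
    rw [LinearMap.mem_ker, map_sub, hφ, sub_self]
  obtain ⟨n', hn', h⟩ := D.mem_oneSubTKer.1 h
  -- The target is `ς(a) + (1 - t)(n' + n)`, and `1 - t` acts as 2 in the quotient. So the
  -- displacement given by a lift of `n' + n` reaches it from `q_a`.
  obtain ⟨f, hf⟩ := (LinearMap.range D.ρ).mkQ_surjective (n' + n)
  obtain ⟨G, hG⟩ := D.exists_isDisplacement a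
  have hf₀ : D.φred (n' + n) = 0 := add_mem hn' hn
  have hsum : D.arcSum (subBase a (finsuppEvalNegOne _ f)) = D.onePlusT.mkQ (n' + n) := by
    have h₁ := arcSum_eq_arcSum_subBase a f
    rwa [hf, hf₀, map_zero, zero_smul, add_zero, ← mk_eq_arcSum, hf, eq_comm] at h₁
  refine ⟨G (ofAdd (finsuppEvalNegOne _ f)) (D.imqGen a), ?_⟩
  refine (hG.imqValue_apply _ _).trans ?_
  rw [imqValue_gen, hsum]
  change _ = D.onePlusT.mkQ (m i + (1 - tΛ) • n)
  rw [sub_eq_iff_eq_add.1 h, ςNegOne, map_add, map_add, map_add, map_smul, map_smul, sub_smul,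
    sub_smul, t_smul_MAredNegOne, t_smul_MAredNegOne]
  module

end LinkDiagram

theorem mainTheorem9 {μ : ℕ} (hμ : μ ≤ 2) (D : LinkDiagram μ) (hD : D.IsClassical)
    (m : Fin μ → D.MAred) (hm : ∀ i, D.IsMeridian i (m i)) :
    QuandleIsomorphic D.IMQ (D.QAredImage m hm).carrier := by
  refine ⟨⟨fun x => ⟨D.imqHom x, LinkDiagram.imqValue_mem m hm x⟩, fun {x y} =>
    Subtype.ext D.imqHom.map_act⟩, fun x y hxy => ?_, fun y => ?_⟩
  · exact LinkDiagram.imqValue_injective hμ hD (congrArg Subtype.val hxy)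
  · obtain ⟨x, hx⟩ := LinkDiagram.exists_imqValue_eq m hm y
    exact ⟨x, Subtype.ext hx⟩

end
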